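/- All algebras are unital and over $\mathbb C$. For an algebra $B$, let $\iota_B\colon B\to\widehat B$ be its Arens--Michael envelope, i.e. the Hausdorff completion of $B$ with respect to the family of all submultiplicative seminorms. For a bialgebra $H$ and an $H$-module algebra $A$, let $A\# H$ be the smash product, that is, the vector space $A\otimes H$ with multiplication $(a\otimes h)(a'\otimes h')=\sum a(h_{(1)}\cdot a')\otimes h_{(2)}h'$. Let $\widetilde A$ be the $H$-completion of $A$, i.e. the Hausdorff completion with respect to all submultiplicative seminorms $\|\cdot\|$ that are $H$-stable (for each $h\in H$ there is $C>0$ with $\|h\cdot a\|\le C\|a\|$ for all $a\in A$). Let $\widetilde A\mathbin{\widehat\#}\widehat H$ be the analytic smash product: the completed projective tensor product $\widetilde A\mathbin{\widehat\otimes}\widehat H$ with the multiplication given by the same formula, where the comultiplication of $H$ and the action of $H$ on $A$ are extended by continuity to $\widehat H\to\widehat H\mathbin{\widehat\otimes}\widehat H$ and $\widehat H\mathbin{\widehat\otimes}\widetilde A\to\widetilde A$. Let $j\colon A\# H\to\widetilde A\mathbin{\widehat\#}\widehat H$, $a\otimes h\mapsto a\otimes h$, be the canonical homomorphism. Let $q\in\mathbb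 C\setminus\{0\}$, let $H=\mathbb C\mathbb Z_+$ be the semigroup bialgebra of $\mathbb Z_+=\{0,1,2,\dots\}$ with basis $(\delta_k)_{k\ge 0}$, and let $A=\mathbb C[x]$ be the $H$-module algebra with the action $(\delta_k\cdot f)(x)=f(q^{-k}x)$. Then: 1. The bialgebra $H$ is not a Hopf algebra. 2. There is an algebra isomorphism from Manin's quantum plane $\mathbb C_q[x,y]=\mathbb C\langle x,y\mid xy=qyx\rangle$ onto $A\# H$ that sends $x$ to $x\otimes 1$ and $y$ to $1\otimes\delta_1$. If moreover $|q|<1$, then: 3. The inclusion $\mathbb C[x]\to\mathbb C[[x]]$ extends to an isomorphism of topological algebras $\widetilde A\cong\mathbb C[[x]]$, where $\mathbb C[[x]]$ carries the topology of coordinatewise convergence. 4. There is an isomorphism of topological vector spaces from $\widetilde A\mathbin{\widehat\#}\widehat H$ onto the space $$\Bigl\{\sum_{i,j\ge 0} c_{ij}x^iy^j : \|c\|_{\rho,N}=\sum_{i=0}^N\sum_{j=0}^\infty|c_{ij}|\rho^j<\infty\ \ \forall\rho>0,\ N\in\mathbb Z_+\Bigr\},$$ with the topology given by the seminorms $\|\cdot\|_{\rho,N}$,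 that sends $x^i\otimes\delta_j$ to $x^iy^j$. 5. There is an isomorphism of topological vector spaces from the Arens--Michael envelope of $\mathbb C_q[x,y]$ onto the space $$\Bigl\{\sum_{i,j\ge 0} c_{ij}x^iy^j : \|c\|_{\rho}=\sum_{i,j=0}^\infty|c_{ij}||q|^{ij}\rho^{i+j}<\infty\ \ \forall\rho>0\Bigr\},$$ with the topology given by the seminorms $\|\cdot\|_\rho$, that sends $\iota(x^iy^j)$ to $x^iy^j$. 6. There is a unique continuous algebra homomorphism $\Phi\colon (A\# H)^{\widehat{\ }}\to\widetilde A\mathbin{\widehat\#}\widehat H$ with $\Phi\circ\iota_{A\# H}=j$, and $\Phi$ is not onto. 7. Consequently $j$ does not extend to an isomorphism of topological algebras $(A\# H)^{\widehat{\ }}\cong\widetilde A\mathbin{\widehat\#}\widehat H$. Thus the theorem that $j$ extends to such an isomorphism for every Hopf algebra $H$ and every $H$-module algebra $A$ cannot be generalized to arbitrary bialgebras $H$. -/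

import Mathlib

noncomputable section

namespace AMSmash

open scoped TensorProduct Topology
open Filter UniformSpace

set_option linter.unusedSectionVars false
set_option linter.unusedSimpArgs false

/-! ### Locally convex spaces

A complex locally convex space is a topological vector space whose topology is generated by
seminorms. -/

/-- Locally convex spaces. -/
class LCS (E : Type*) [AddCommGroup E] [Module ℂ E] [UniformSpace E] : Prop
    extends IsUniformAddGroup E, ContinuousSMul ℂ E, PolynormableSpace ℂ E

/-- Complete Hausdorff locally convex spaces. -/
class CompleteLCS (E : Type*) [AddCommGroup E] [Module ℂ E] [UniformSpace E] : Prop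
    extends LCS E, CompleteSpace E, T2Space E

/-- The vector space `E` with the locally convex topology generated by a set `S` of seminorms. -/
def SemTop (E : Type*) [AddCommGroup E] [Module ℂ E] (_S : Set (Seminorm ℂ E)) : Type _ := E

namespace SemTop

variable {E : Type*} [AddCommGroup E] [Module ℂ E] (S : Set (Seminorm ℂ E))

instance : AddCommGroup (SemTop E S) := inferInstanceAs (AddCommGroup E)
instance : Module ℂ (SemTop E S) := inferInstanceAs (Module ℂ E)

instance : UniformSpace (SemTop E S) :=
  ⨅ p : S, (p : Seminorm ℂ E).toSeminormedAddCommGroup.toUniformSpace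

instance : IsUniformAddGroup (SemTop E S) := by
  refine isUniformAddGroup_iInf fun p => ?_
  exact @SeminormedAddCommGroup.to_isUniformAddGroup E (p : Seminorm ℂ E).toSeminormedAddCommGroup

/-- The seminorms in `S`, seen on the space that they topologise. -/
def family : SeminormFamily ℂ (SemTop E S) S := fun p => (p : Seminorm ℂ E)

theorem withSeminorms : WithSeminorms (family S) := by
  rw [SeminormFamily.withSeminorms_iff_uniformSpace_eq_iInf]
  rfl

instance : LCS (SemTop E S) where
  __ := (inferInstance : IsUniformAddGroup (SemTop E S))
  __ := (withSeminorms S).continuousSMul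
  __ := (withSeminorms S).toPolynormableSpace

/-- A family of seminorms that contains `0` and is closed under maxima and under
multiplication by constants `≥ 1`. -/
structure Saturated : Prop where
  bot_mem : (⊥ : Seminorm ℂ E) ∈ S
  sup_mem : ∀ p ∈ S, ∀ q ∈ S, p ⊔ q ∈ S
  smul_mem : ∀ p ∈ S, ∀ C : NNReal, 1 ≤ C → C • p ∈ S

theorem continuous_of_mem {p : Seminorm ℂ E} (hp : p ∈ S) :
    Continuous (fun x : SemTop E S => p x) :=
  (withSeminorms S).continuous_seminorm ⟨p, hp⟩

theorem Saturated.exists_le {S : Set (Seminorm ℂ E)} (hS : Saturated S)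
    (r : Seminorm ℂ (SemTop E S)) (hr : Continuous r) : ∃ p ∈ S, ∀ x : E, r x ≤ p x := by
  obtain ⟨s, C, -, h⟩ := Seminorm.bound_of_continuous (withSeminorms S) r hr
  have h1 : ∀ s : Finset S, ∃ p ∈ S, ∀ x : E, (s.sup (family S)) x ≤ p x := by
    intro s
    classical
    induction s using Finset.induction_on with
    | empty => exact ⟨⊥, hS.bot_mem, fun x => le_rfl⟩
    | insert a s _ ih =>
      obtain ⟨p, hp, hsp⟩ := ih
      refine ⟨a.1 ⊔ p, hS.sup_mem _ a.2 _ hp, fun x => ?_⟩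
      rw [Finset.sup_insert]
      exact max_le_max le_rfl (hsp x)
  obtain ⟨p, hp, hsp⟩ := h1 s
  refine ⟨(max C 1) • p, hS.smul_mem p hp _ (le_max_right _ _), fun x => (h x).trans ?_⟩
  change (C : ℝ) * (s.sup (family S)) x ≤ ((max C 1 : NNReal) : ℝ) * p x
  exact mul_le_mul (by exact_mod_cast le_max_left C 1) (hsp x) (apply_nonneg _ _) (by positivity)

end SemTop

instance {E : Type*} [AddCommGroup E] [Module ℂ E] [UniformSpace E] [LCS E] :
    UniformContinuousConstSMul ℂ E :=
  uniformContinuousConstSMul_of_continuousConstSMul ℂ E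

section

variable {E F G : Type*} [AddCommGroup E] [Module ℂ E] [UniformSpace E] [LCS E]
  [AddCommGroup F] [Module ℂ F] [UniformSpace F] [LCS F]
  [AddCommGroup G] [Module ℂ G] [UniformSpace G] [LCS G]

theorem exists_seminorm_of_mem_nhds {U : Set E} (hU : U ∈ 𝓝 (0 : E)) :
    ∃ p : Seminorm ℂ E, Continuous p ∧ ∀ x, p x < 1 → x ∈ U := by
  obtain ⟨⟨s, r⟩, hr, hs⟩ := (PolynormableSpace.withSeminorms ℂ E).hasBasis_zero_ball.mem_iff.1 hU
  have hr' : (0 : ℝ) < r := hr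
  let c : NNReal := ⟨r⁻¹, by positivity⟩
  refine ⟨c • s.sup (fun p : {p : Seminorm ℂ E // Continuous p} ↦ p.1), ?_, fun x hx => hs ?_⟩
  · exact (Seminorm.continuous_finsetSup fun i _ => i.2).const_smul c
  · rw [Seminorm.mem_ball_zero]
    have : r⁻¹ * (s.sup (fun p : {p : Seminorm ℂ E // Continuous p} ↦ p.1)) x < 1 := hx
    rwa [inv_mul_lt_iff₀ hr', mul_one] at this

/-- A jointly continuous bilinear map. -/
structure CBilin (E F G : Type*) [AddCommGroup E] [Module ℂ E] [UniformSpace E]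
    [AddCommGroup F] [Module ℂ F] [UniformSpace F]
    [AddCommGroup G] [Module ℂ G] [UniformSpace G] where
  toBilin : E →ₗ[ℂ] F →ₗ[ℂ] G
  cont : Continuous fun z : E × F => toBilin z.1 z.2

theorem CBilin.exists_bound (β : CBilin E F G) (r : Seminorm ℂ G) (hr : Continuous r) :
    ∃ (p : Seminorm ℂ E) (q : Seminorm ℂ F), Continuous p ∧ Continuous q ∧
      ∀ e f, r (β.toBilin e f) ≤ p e * q f := by
  have h0 : {z : E × F | r (β.toBilin z.1 z.2) < 1} ∈ 𝓝 ((0 : E), (0 : F)) := by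
    apply (isOpen_lt (hr.comp β.cont) continuous_const).mem_nhds
    simp
  rw [nhds_prod_eq, mem_prod_iff] at h0
  obtain ⟨U, hU, V, hV, hUV⟩ := h0
  obtain ⟨p, hp, hpU⟩ := exists_seminorm_of_mem_nhds hU
  obtain ⟨q, hq, hqV⟩ := exists_seminorm_of_mem_nhds hV
  refine ⟨p, q, hp, hq, fun e f => ?_⟩
  have key : ∀ ε : ℝ, 0 < ε → r (β.toBilin e f) ≤ (p e + ε) * (q f + ε) := by
    intro ε hε
    have h1 : 0 < p e + ε := add_pos_of_nonneg_of_pos (apply_nonneg p e) hε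
    have h2 : 0 < q f + ε := add_pos_of_nonneg_of_pos (apply_nonneg q f) hε
    have := @hUV ((((p e + ε)⁻¹ : ℝ) : ℂ) • e, (((q f + ε)⁻¹ : ℝ) : ℂ) • f) ⟨hpU _ ?_, hqV _ ?_⟩
    · simp only [Set.mem_ofPred_eq, map_smul, LinearMap.smul_apply, map_smul_eq_mul,
        Complex.norm_real, norm_inv, Real.norm_of_nonneg h1.le, Real.norm_of_nonneg h2.le] at this
      rw [inv_mul_lt_iff₀ h2, inv_mul_lt_iff₀ h1] at this
      linarith
    · simp only [map_smul_eq_mul, Complex.norm_real, norm_inv, Real.norm_of_nonneg h1.le]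
      rw [inv_mul_lt_iff₀ h1]; linarith
    · simp only [map_smul_eq_mul, Complex.norm_real, norm_inv, Real.norm_of_nonneg h2.le]
      rw [inv_mul_lt_iff₀ h2]; linarith
  have ht : Tendsto (fun ε : ℝ => (p e + ε) * (q f + ε)) (𝓝[>] 0) (𝓝 (p e * q f)) := by
    have : Continuous (fun ε : ℝ => (p e + ε) * (q f + ε)) := by fun_prop
    have := this.tendsto 0
    simp only [add_zero] at this
    exact this.mono_left nhdsWithin_le_nhds
  exact ge_of_tendsto ht (eventually_mem_nhdsWithin.mono fun ε hε => key ε hε)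

/-- A bilinear map that is bounded in every continuous seminorm is jointly continuous. -/
theorem continuous_of_bound (β : E →ₗ[ℂ] F →ₗ[ℂ] G)
    (h : ∀ r : Seminorm ℂ G, Continuous r → ∃ (p : Seminorm ℂ E) (q : Seminorm ℂ F),
      Continuous p ∧ Continuous q ∧ ∀ e f, r (β e f) ≤ p e * q f) :
    Continuous fun z : E × F => β z.1 z.2 := by
  rw [continuous_iff_continuousAt]
  rintro ⟨e₀, f₀⟩
  refine ((PolynormableSpace.withSeminorms ℂ G).tendsto_nhds' _ _).2 fun s ε hε => ?_
  set r : Seminorm ℂ G := s.sup (fun p : {p : Seminorm ℂ G // Continuous p} ↦ p.1)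
  have hs : Continuous r := Seminorm.continuous_finsetSup fun i _ => i.2
  obtain ⟨p, q, hp, hq, hpq⟩ := h r hs
  have hb : ∀ z : E × F, r (β z.1 z.2 - β e₀ f₀) ≤
      p (z.1 - e₀) * q (z.2 - f₀) + p e₀ * q (z.2 - f₀) + p (z.1 - e₀) * q f₀ := by
    intro z
    have : β z.1 z.2 - β e₀ f₀ =
        β (z.1 - e₀) (z.2 - f₀) + β e₀ (z.2 - f₀) + β (z.1 - e₀) f₀ := by
      simp only [map_sub, LinearMap.sub_apply]; abel
    rw [this]
    refine (map_add_le_add r _ _).trans (add_le_add ((map_add_le_add r _ _).trans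
      (add_le_add (hpq _ _) (hpq _ _))) (hpq _ _))
  have hc : Continuous fun z : E × F =>
      p (z.1 - e₀) * q (z.2 - f₀) + p e₀ * q (z.2 - f₀) + p (z.1 - e₀) * q f₀ := by
    have h1 : Continuous fun z : E × F => p (z.1 - e₀) := hp.comp (by fun_prop)
    have h2 : Continuous fun z : E × F => q (z.2 - f₀) := hq.comp (by fun_prop)
    fun_prop
  have := hc.tendsto (e₀, f₀)
  simp only [sub_self, map_zero, mul_zero, zero_mul, add_zero] at this
  filter_upwards [this.eventually (gt_mem_nhds hε)] with z hz
  exact (hb z).trans_lt hz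

/-- The continuous extension of a continuous seminorm to the completion. -/
def completionSeminorm (p : Seminorm ℂ E) (hp : Continuous p) : Seminorm ℂ (Completion E) :=
  have hu : UniformContinuous p := Seminorm.uniformContinuous_of_continuousAt_zero hp.continuousAt
  have hc : Continuous (Completion.extension p) := Completion.continuous_extension
  Seminorm.of (Completion.extension p)
    (fun x y => by
      induction x, y using Completion.induction_on₂ with
      | hp => exact isClosed_le (by fun_prop) (by fun_prop)
      | ih x y =>
        rw [← Completion.coe_add]
        simp only [Completion.extension_coe hu]
        exact map_add_le_add p x y)
    (fun c x => by
      induction x using Completion.induction_on with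
      | hp => exact isClosed_eq (hc.comp (continuous_const_smul c)) (by fun_prop)
      | ih x =>
        rw [← Completion.coe_smul]
        simp only [Completion.extension_coe hu]
        exact map_smul_eq_mul p c x)

theorem completionSeminorm_coe (p : Seminorm ℂ E) (hp : Continuous p) (x : E) :
    completionSeminorm p hp (x : Completion E) = p x :=
  Completion.extension_coe (Seminorm.uniformContinuous_of_continuousAt_zero hp.continuousAt) x

theorem continuous_completionSeminorm (p : Seminorm ℂ E) (hp : Continuous p) :
    Continuous (completionSeminorm p hp) :=
  Completion.continuous_extension (f := p)

theorem completion_withSeminorms :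
    WithSeminorms (fun p : {p : Seminorm ℂ E // Continuous p} => completionSeminorm p.1 p.2) := by
  rw [SeminormFamily.withSeminorms_iff_nhds_eq_iInf]
  refine le_antisymm (le_iInf fun p => ?_) fun U hU => ?_
  · rw [← map_le_iff_le_comap]
    have := (continuous_completionSeminorm p.1 p.2).tendsto 0
    rwa [map_zero] at this
  · obtain ⟨V, hV, hVc, hVU⟩ := exists_mem_nhds_isClosed_subset hU
    have h1 : (fun x : E => (x : Completion E)) ⁻¹' V ∈ 𝓝 (0 : E) := by
      apply (Completion.continuous_coe E).continuousAt.preimage_mem_nhds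
      rwa [Completion.coe_zero]
    obtain ⟨p, hp, hpV⟩ := exists_seminorm_of_mem_nhds h1
    refine mem_iInf_of_mem ⟨p, hp⟩ ⟨Set.Iio 1, Iio_mem_nhds zero_lt_one, fun x hx => hVU ?_⟩
    have ho : IsOpen {x | completionSeminorm p hp x < 1} :=
      isOpen_lt (continuous_completionSeminorm p hp) continuous_const
    have hd := (Completion.denseRange_coe (α := E)).open_subset_closure_inter ho hx
    refine hVc.closure_subset_iff.2 ?_ hd
    rintro _ ⟨hy, y, rfl⟩
    refine hpV y ?_
    have : completionSeminorm p hp (y : Completion E) < 1 := hy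
    rwa [completionSeminorm_coe] at this

instance : CompleteLCS (Completion E) where
  __ := (inferInstance : IsUniformAddGroup (Completion E))
  __ := (completion_withSeminorms (E := E)).continuousSMul
  __ := (completion_withSeminorms (E := E)).toPolynormableSpace
  __ := (inferInstance : CompleteSpace (Completion E))
  __ := (inferInstance : T2Space (Completion E))

/-- The canonical map of a locally convex space to its Hausdorff completion. -/
def toCompl (E : Type*) [AddCommGroup E] [Module ℂ E] [UniformSpace E] [LCS E] :
    E →L[ℂ] Completion E where
  toFun x := x
  map_add' x y := Completion.coe_add x y
  map_smul' c x := Completion.coe_smul c x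
  cont := Completion.continuous_coe E

theorem isUniformInducing_toCompl : IsUniformInducing (toCompl E) :=
  Completion.isUniformInducing_coe E

theorem denseRange_toCompl : DenseRange (toCompl E) := Completion.denseRange_coe

theorem isDenseInducing_toCompl : IsDenseInducing (toCompl E) :=
  isUniformInducing_toCompl.isDenseInducing denseRange_toCompl

end

section Extend

variable {E F G E' F' : Type*} [AddCommGroup E] [Module ℂ E] [UniformSpace E] [LCS E]
  [AddCommGroup F] [Module ℂ F] [UniformSpace F] [LCS F]
  [AddCommGroup G] [Module ℂ G] [UniformSpace G] [CompleteLCS G]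
  [AddCommGroup E'] [Module ℂ E'] [UniformSpace E'] [LCS E']
  [AddCommGroup F'] [Module ℂ F'] [UniformSpace F'] [LCS F']

/-- Extension by continuity of a jointly continuous bilinear map. -/
def CBilin.extend (β : CBilin E F G) (i : E →L[ℂ] E') (j : F →L[ℂ] F')
    (hi : IsDenseInducing i) (hj : IsDenseInducing j) : CBilin E' F' G :=
  let ψ : E' × F' → G := (hi.prodMap hj).extend fun z : E × F => β.toBilin z.1 z.2
  have hψ : Continuous ψ :=
    IsDenseInducing.extend_Z_bilin (e := (i : E →+ E')) (f := (j : F →+ F')) hi hj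
      (φ := (LinearMap.toAddMonoidHom'.comp β.toBilin.toAddMonoidHom)) β.cont
  have he : ∀ e f, ψ (i e, j f) = β.toBilin e f := fun e f =>
    (hi.prodMap hj).extend_eq β.cont (e, f)
  { toBilin := LinearMap.mk₂ ℂ (fun e f => ψ (e, f))
      (fun x y f => congr_fun ((hi.dense.prodMap (hi.dense.prodMap hj.dense)).equalizer
          (g := fun z : E' × E' × F' => ψ (z.1 + z.2.1, z.2.2))
          (h := fun z : E' × E' × F' => ψ (z.1, z.2.2) + ψ (z.2.1, z.2.2))
          (by fun_prop) (by fun_prop) (funext fun z => by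
            change ψ (i z.1 + i z.2.1, j z.2.2) = ψ (i z.1, j z.2.2) + ψ (i z.2.1, j z.2.2)
            rw [← map_add i, he, he, he, map_add, LinearMap.add_apply])) (x, y, f))
      (fun c x f => congr_fun ((hi.dense.prodMap hj.dense).equalizer
          (g := fun z : E' × F' => ψ (c • z.1, z.2)) (h := fun z : E' × F' => c • ψ z)
          (by fun_prop) (by fun_prop) (funext fun z => by
            change ψ (c • i z.1, j z.2) = c • ψ (i z.1, j z.2)
            rw [← map_smul i, he, he, map_smul, LinearMap.smul_apply])) (x, f))
      (fun x f g => congr_fun ((hi.dense.prodMap (hj.dense.prodMap hj.dense)).equalizer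
          (g := fun z : E' × F' × F' => ψ (z.1, z.2.1 + z.2.2))
          (h := fun z : E' × F' × F' => ψ (z.1, z.2.1) + ψ (z.1, z.2.2))
          (by fun_prop) (by fun_prop) (funext fun z => by
            change ψ (i z.1, j z.2.1 + j z.2.2) = ψ (i z.1, j z.2.1) + ψ (i z.1, j z.2.2)
            rw [← map_add j, he, he, he, map_add])) (x, f, g))
      (fun c x f => congr_fun ((hi.dense.prodMap hj.dense).equalizer
          (g := fun z : E' × F' => ψ (z.1, c • z.2)) (h := fun z : E' × F' => c • ψ z)
          (by fun_prop) (by fun_prop) (funext fun z => by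
            change ψ (i z.1, c • j z.2) = c • ψ (i z.1, j z.2)
            rw [← map_smul j, he, he, map_smul])) (x, f))
    cont := hψ }

theorem CBilin.extend_apply (β : CBilin E F G) (i : E →L[ℂ] E') (j : F →L[ℂ] F')
    (hi : IsDenseInducing i) (hj : IsDenseInducing j) (e : E) (f : F) :
    (β.extend i j hi hj).toBilin (i e) (j f) = β.toBilin e f :=
  (hi.prodMap hj).extend_eq β.cont (e, f)

end Extend

/-! ### The completed projective tensor product -/

section Proj

/-- The projective topology on `E ⊗ F` is generated by the seminorms for which the canonical
bilinear map `E × F → E ⊗ F` is jointly continuous. -/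
def projSeminorms (E F : Type*) [AddCommGroup E] [Module ℂ E] [TopologicalSpace E]
    [AddCommGroup F] [Module ℂ F] [TopologicalSpace F] : Set (Seminorm ℂ (E ⊗[ℂ] F)) :=
  {r | ∃ (p : Seminorm ℂ E) (q : Seminorm ℂ F), Continuous p ∧ Continuous q ∧
    ∀ e f, r (e ⊗ₜ f) ≤ p e * q f}

theorem projSeminorms_saturated (E F : Type*) [AddCommGroup E] [Module ℂ E] [UniformSpace E] [LCS E]
    [AddCommGroup F] [Module ℂ F] [UniformSpace F] [LCS F] :
    SemTop.Saturated (projSeminorms E F) where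
  bot_mem := ⟨⊥, ⊥, continuous_const, continuous_const, fun e f => by simp⟩
  sup_mem := by
    rintro r ⟨p, q, hp, hq, h⟩ r' ⟨p', q', hp', hq', h'⟩
    refine ⟨p ⊔ p', q ⊔ q', hp.sup hp', hq.sup hq', fun e f => ?_⟩
    simp only [Seminorm.sup_apply]
    exact max_le
      ((h e f).trans (mul_le_mul (le_max_left _ _) (le_max_left _ _) (by simp) (by simp)))
      ((h' e f).trans (mul_le_mul (le_max_right _ _) (le_max_right _ _) (by simp) (by simp)))
  smul_mem := by
    rintro r ⟨p, q, hp, hq, h⟩ C -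
    refine ⟨C • p, q, hp.const_smul C, hq, fun e f => ?_⟩
    simp only [smul_apply, NNReal.smul_def, smul_eq_mul, mul_assoc]
    exact mul_le_mul_of_nonneg_left (h e f) C.2

/-- The completed projective tensor product `E ⊗̂ F`. -/
def CTP (E F : Type*) [AddCommGroup E] [Module ℂ E] [TopologicalSpace E]
    [AddCommGroup F] [Module ℂ F] [TopologicalSpace F] : Type _ :=
  Completion (SemTop (E ⊗[ℂ] F) (projSeminorms E F))

namespace CTP

section basic
variable (E F : Type*) [AddCommGroup E] [Module ℂ E] [TopologicalSpace E]
  [AddCommGroup F] [Module ℂ F] [TopologicalSpace F]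

instance : AddCommGroup (CTP E F) :=
  inferInstanceAs (AddCommGroup (Completion (SemTop (E ⊗[ℂ] F) (projSeminorms E F))))
instance : Module ℂ (CTP E F) :=
  inferInstanceAs (Module ℂ (Completion (SemTop (E ⊗[ℂ] F) (projSeminorms E F))))
instance : UniformSpace (CTP E F) :=
  inferInstanceAs (UniformSpace (Completion (SemTop (E ⊗[ℂ] F) (projSeminorms E F))))
instance : CompleteLCS (CTP E F) :=
  inferInstanceAs (CompleteLCS (Completion (SemTop (E ⊗[ℂ] F) (projSeminorms E F))))

/-- The canonical map from `E ⊗ F` (with the projective topology) to `E ⊗̂ F`. -/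
def ofSemTop : SemTop (E ⊗[ℂ] F) (projSeminorms E F) →L[ℂ] CTP E F := toCompl _

/-- The canonical linear map `E ⊗ F → E ⊗̂ F`. -/
def ofTensor : E ⊗[ℂ] F →ₗ[ℂ] CTP E F :=
  ((ofSemTop E F : SemTop (E ⊗[ℂ] F) (projSeminorms E F) →ₗ[ℂ] CTP E F) :)

theorem denseRange_ofTensor : DenseRange (ofTensor E F) :=
  denseRange_toCompl (E := SemTop (E ⊗[ℂ] F) (projSeminorms E F))

end basic

variable {E F G K : Type*} [AddCommGroup E] [Module ℂ E] [UniformSpace E] [LCS E]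
  [AddCommGroup F] [Module ℂ F] [UniformSpace F] [LCS F]
  [AddCommGroup G] [Module ℂ G] [UniformSpace G] [LCS G]
  [AddCommGroup K] [Module ℂ K] [UniformSpace K] [CompleteLCS K]

/-- The canonical bilinear map `E × F → E ⊗̂ F`. -/
def tmul (E F : Type*) [AddCommGroup E] [Module ℂ E] [UniformSpace E] [LCS E]
    [AddCommGroup F] [Module ℂ F] [UniformSpace F] [LCS F] : CBilin E F (CTP E F) where
  toBilin := (TensorProduct.mk ℂ E F).compr₂ (ofTensor E F)
  cont := by
    refine continuous_of_bound _ fun r hr => ?_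
    obtain ⟨r', ⟨p, q, hp, hq, h⟩, hr'⟩ := (projSeminorms_saturated E F).exists_le
      (r.comp (ofSemTop E F : SemTop (E ⊗[ℂ] F) (projSeminorms E F) →ₗ[ℂ] CTP E F))
      (hr.comp (ofSemTop E F).continuous)
    exact ⟨p, q, hp, hq, fun e f => (hr' (e ⊗ₜ f)).trans (h e f)⟩

theorem continuous_tensorLift (β : CBilin E F G) :
    Continuous (fun t : SemTop (E ⊗[ℂ] F) (projSeminorms E F) =>
      (TensorProduct.lift β.toBilin : E ⊗[ℂ] F →ₗ[ℂ] G) t) := by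
  refine WithSeminorms.continuous_of_continuous_comp (PolynormableSpace.withSeminorms ℂ G)
    (show SemTop (E ⊗[ℂ] F) (projSeminorms E F) →ₗ[ℂ] G from TensorProduct.lift β.toBilin)
    fun r => ?_
  obtain ⟨p, q, hp, hq, h⟩ := β.exists_bound r.1 r.2
  exact SemTop.continuous_of_mem (projSeminorms E F)
    (p := r.1.comp (TensorProduct.lift β.toBilin)) ⟨p, q, hp, hq, fun e f => by simpa using h e f⟩

/-- The continuous linear map on `E ⊗̂ F` given by a jointly continuous bilinear map. -/
def lift (β : CBilin E F K) : CTP E F →L[ℂ] K :=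
  ContinuousLinearMap.extend
    (⟨(show SemTop (E ⊗[ℂ] F) (projSeminorms E F) →ₗ[ℂ] K from TensorProduct.lift β.toBilin),
      continuous_tensorLift β⟩ : SemTop (E ⊗[ℂ] F) (projSeminorms E F) →L[ℂ] K)
    (ofSemTop E F)

theorem lift_ofTensor (β : CBilin E F K) (t : E ⊗[ℂ] F) :
    lift β (ofTensor E F t) = TensorProduct.lift β.toBilin t :=
  ContinuousLinearMap.extend_eq _ denseRange_toCompl isUniformInducing_toCompl _

end CTP
end Proj

section ProjSeminorm

variable {E F : Type*} [AddCommGroup E] [Module ℂ E] [AddCommGroup F] [Module ℂ F]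

/-- The projective tensor product of two seminorms: the largest seminorm `r` on `E ⊗ F` with
`r (e ⊗ f) ≤ p e * q f`. -/
def projSeminorm (p : Seminorm ℂ E) (q : Seminorm ℂ F) : Seminorm ℂ (E ⊗[ℂ] F) :=
  sSup {r | ∀ e f, r (e ⊗ₜ f) ≤ p e * q f}

theorem bddAbove_projSeminorm (p : Seminorm ℂ E) (q : Seminorm ℂ F) :
    BddAbove {r : Seminorm ℂ (E ⊗[ℂ] F) | ∀ e f, r (e ⊗ₜ f) ≤ p e * q f} := by
  rw [Seminorm.bddAbove_iff]
  have : ∀ t : E ⊗[ℂ] F, ∃ M : ℝ, ∀ r : Seminorm ℂ (E ⊗[ℂ] F),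
      (∀ e f, r (e ⊗ₜ f) ≤ p e * q f) → r t ≤ M := by
    intro t
    induction t using TensorProduct.induction_on with
    | zero => exact ⟨0, fun r _ => by simp⟩
    | tmul e f => exact ⟨_, fun r hr => hr e f⟩
    | add x y hx hy =>
      obtain ⟨M, hM⟩ := hx
      obtain ⟨N, hN⟩ := hy
      exact ⟨M + N, fun r hr => (map_add_le_add r x y).trans (add_le_add (hM r hr) (hN r hr))⟩
  choose M hM using this
  refine ⟨M, ?_⟩
  rintro _ ⟨r, hr, rfl⟩ t
  exact hM t r hr

theorem projSeminorm_tmul_le (p : Seminorm ℂ E) (q : Seminorm ℂ F) (e : E) (f : F) :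
    projSeminorm p q (e ⊗ₜ f) ≤ p e * q f := by
  rw [projSeminorm, Seminorm.sSup_apply (bddAbove_projSeminorm p q)]
  refine Real.iSup_le (fun r => r.2 e f) (mul_nonneg (apply_nonneg _ _) (apply_nonneg _ _))

theorem le_projSeminorm {p : Seminorm ℂ E} {q : Seminorm ℂ F} {r : Seminorm ℂ (E ⊗[ℂ] F)} {C : ℝ}
    (hC : 0 ≤ C) (h : ∀ e f, r (e ⊗ₜ f) ≤ C * (p e * q f)) (t : E ⊗[ℂ] F) :
    r t ≤ C * projSeminorm p q t := by
  rcases hC.eq_or_lt with rfl | hC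
  · have : r t ≤ 0 := by
      induction t using TensorProduct.induction_on with
      | zero => simp
      | tmul e f => simpa using h e f
      | add x y hx hy => exact (map_add_le_add r x y).trans (by linarith)
    simpa using this
  · have h1 : (Real.toNNReal C⁻¹) • r ≤ projSeminorm p q := by
      refine le_csSup (bddAbove_projSeminorm p q) fun e f => ?_
      change ((Real.toNNReal C⁻¹ : NNReal) : ℝ) * r (e ⊗ₜ f) ≤ _
      rw [Real.coe_toNNReal _ (by positivity)]
      rw [inv_mul_le_iff₀ hC]
      exact h e f
    have h2 : ((Real.toNNReal C⁻¹ : NNReal) : ℝ) * r t ≤ projSeminorm p q t := h1 t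
    rw [Real.coe_toNNReal _ (by positivity)] at h2
    rwa [inv_mul_le_iff₀ hC] at h2

end ProjSeminorm

namespace CTP

variable {E F G K E' F' : Type*} [AddCommGroup E] [Module ℂ E] [UniformSpace E] [LCS E]
  [AddCommGroup F] [Module ℂ F] [UniformSpace F] [LCS F]
  [AddCommGroup G] [Module ℂ G] [UniformSpace G] [LCS G]
  [AddCommGroup K] [Module ℂ K] [UniformSpace K] [CompleteLCS K]
  [AddCommGroup E'] [Module ℂ E'] [UniformSpace E'] [LCS E']
  [AddCommGroup F'] [Module ℂ F'] [UniformSpace F'] [LCS F']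

/-- The elementary tensor `e ⊗ f` in `E ⊗̂ F`. -/
def mk (e : E) (f : F) : CTP E F := (tmul E F).toBilin e f

theorem add_mk (e e' : E) (f : F) : mk (e + e') f = mk e f + mk e' f := by simp [mk]

theorem mk_add (e : E) (f f' : F) : mk e (f + f') = mk e f + mk e f' := by simp [mk]

theorem zero_mk (f : F) : mk (0 : E) f = 0 := by simp [mk]

theorem mk_zero (e : E) : mk e (0 : F) = 0 := by simp [mk]

theorem smul_mk (c : ℂ) (e : E) (f : F) : mk (c • e) f = c • mk e f := by simp [mk]

theorem mk_smul (c : ℂ) (e : E) (f : F) : mk e (c • f) = c • mk e f := by simp [mk]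

theorem ofTensor_tmul (e : E) (f : F) : ofTensor E F (e ⊗ₜ f) = mk e f := rfl

theorem lift_mk (β : CBilin E F K) (e : E) (f : F) : lift β (mk e f) = β.toBilin e f := by
  rw [← ofTensor_tmul, lift_ofTensor, TensorProduct.lift.tmul]

/-- The continuous linear map `f ⊗̂ g`. -/
def map (f : E →L[ℂ] E') (g : F →L[ℂ] F') : CTP E F →L[ℂ] CTP E' F' :=
  lift ⟨(tmul E' F').toBilin.compl₁₂ f.toLinearMap g.toLinearMap,
    (tmul E' F').cont.comp (f.continuous.prodMap g.continuous)⟩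

theorem map_mk (f : E →L[ℂ] E') (g : F →L[ℂ] F') (e : E) (x : F) :
    map f g (mk e x) = mk (f e) (g x) := lift_mk _ _ _

/-- The flip `E ⊗̂ F → F ⊗̂ E`. -/
def comm (E F : Type*) [AddCommGroup E] [Module ℂ E] [UniformSpace E] [LCS E]
    [AddCommGroup F] [Module ℂ F] [UniformSpace F] [LCS F] : CTP E F →L[ℂ] CTP F E :=
  lift ⟨(tmul F E).toBilin.flip, (tmul F E).cont.comp continuous_swap⟩

theorem comm_mk (e : E) (f : F) : comm E F (mk e f) = mk f e := lift_mk _ _ _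

/-- The map `(E ⊗ F) × G → E ⊗̂ (F ⊗̂ G)`, `(e ⊗ f, g) ↦ e ⊗ (f ⊗ g)`. -/
def assocAux (E F G : Type*) [AddCommGroup E] [Module ℂ E] [UniformSpace E] [LCS E]
    [AddCommGroup F] [Module ℂ F] [UniformSpace F] [LCS F]
    [AddCommGroup G] [Module ℂ G] [UniformSpace G] [LCS G] :
    E ⊗[ℂ] F →ₗ[ℂ] G →ₗ[ℂ] CTP E (CTP F G) :=
  TensorProduct.lift <| LinearMap.mk₂ ℂ
    (fun e f => (tmul E (CTP F G)).toBilin e ∘ₗ (tmul F G).toBilin f)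
    (fun _ _ _ => by ext; simp) (fun _ _ _ => by ext; simp)
    (fun _ _ _ => by ext; simp) (fun _ _ _ => by ext; simp)

/-- The associativity map `(E ⊗̂ F) ⊗̂ G → E ⊗̂ (F ⊗̂ G)`. -/
def assoc (E F G : Type*) [AddCommGroup E] [Module ℂ E] [UniformSpace E] [LCS E]
    [AddCommGroup F] [Module ℂ F] [UniformSpace F] [LCS F]
    [AddCommGroup G] [Module ℂ G] [UniformSpace G] [LCS G] :
    CTP (CTP E F) G →L[ℂ] CTP E (CTP F G) :=
  lift <| CBilin.extend
    (⟨(show SemTop (E ⊗[ℂ] F) (projSeminorms E F) →ₗ[ℂ] G →ₗ[ℂ] CTP E (CTP F G) from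
        assocAux E F G), by
      refine continuous_of_bound _ fun r hr => ?_
      obtain ⟨p, q, hp, hq, h⟩ := (tmul E (CTP F G)).exists_bound r hr
      obtain ⟨p', q', hp', hq', h'⟩ := (tmul F G).exists_bound q hq
      refine ⟨projSeminorm p p', q', ?_, hq', fun t g => ?_⟩
      · exact SemTop.continuous_of_mem (projSeminorms E F)
          ⟨p, p', hp, hp', projSeminorm_tmul_le p p'⟩
      · rw [mul_comm]
        refine le_projSeminorm (r := r.comp ((assocAux E F G).flip g)) (apply_nonneg q' g)
          (fun e f => ?_) t
        calc r (mk e (mk f g)) ≤ p e * q (mk f g) := h _ _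
          _ ≤ p e * (p' f * q' g) := by gcongr; exact h' _ _
          _ = q' g * (p e * p' f) := by ring⟩ :
      CBilin (SemTop (E ⊗[ℂ] F) (projSeminorms E F)) G (CTP E (CTP F G)))
    (ofSemTop E F) (ContinuousLinearMap.id ℂ G)
    (isDenseInducing_toCompl (E := SemTop (E ⊗[ℂ] F) (projSeminorms E F)))
    ⟨.id, denseRange_id⟩

theorem assoc_mk (e : E) (f : F) (g : G) :
    assoc E F G (mk (mk e f) g) = mk e (mk f g) := by
  rw [assoc, lift_mk]
  exact CBilin.extend_apply _ _ _ _ _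
    (show SemTop (E ⊗[ℂ] F) (projSeminorms E F) from e ⊗ₜ[ℂ] f) g

/-- The inverse associativity map `E ⊗̂ (F ⊗̂ G) → (E ⊗̂ F) ⊗̂ G`. -/
def assocSymm (E F G : Type*) [AddCommGroup E] [Module ℂ E] [UniformSpace E] [LCS E]
    [AddCommGroup F] [Module ℂ F] [UniformSpace F] [LCS F]
    [AddCommGroup G] [Module ℂ G] [UniformSpace G] [LCS G] :
    CTP E (CTP F G) →L[ℂ] CTP (CTP E F) G :=
  (comm G (CTP E F)) ∘L (map (ContinuousLinearMap.id ℂ G) (comm F E)) ∘L (assoc G F E) ∘L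
    (map (comm F G) (ContinuousLinearMap.id ℂ E)) ∘L (comm E (CTP F G))

theorem assocSymm_mk (e : E) (f : F) (g : G) :
    assocSymm E F G (mk e (mk f g)) = mk (mk e f) g := by
  simp only [assocSymm, ContinuousLinearMap.comp_apply, comm_mk, map_mk, assoc_mk,
    ContinuousLinearMap.id_apply]

end CTP

/-! ### Arens-Michael envelopes -/

section Submul

/-- The submultiplicative seminorms on an algebra. -/
def submulSeminorms (A : Type*) [Ring A] [Algebra ℂ A] : Set (Seminorm ℂ A) :=
  {p | ∀ a b, p (a * b) ≤ p a * p b}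

/-- A saturated family of submultiplicative seminorms. -/
class SubmulFamily {A : Type*} [Ring A] [Algebra ℂ A] (S : Set (Seminorm ℂ A)) : Prop where
  subset : S ⊆ submulSeminorms A
  saturated : SemTop.Saturated S

variable {A : Type*} [Ring A] [Algebra ℂ A]

instance (S : Set (Seminorm ℂ A)) : Ring (SemTop A S) := inferInstanceAs (Ring A)
instance (S : Set (Seminorm ℂ A)) : Algebra ℂ (SemTop A S) := inferInstanceAs (Algebra ℂ A)

instance (S : Set (Seminorm ℂ A)) [hS : SubmulFamily S] : IsTopologicalRing (SemTop A S) where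
  continuous_mul := by
    refine continuous_of_bound (LinearMap.mul ℂ (SemTop A S)) fun r hr => ?_
    obtain ⟨p, hp, hrp⟩ := hS.saturated.exists_le r hr
    exact ⟨p, p, SemTop.continuous_of_mem S hp, SemTop.continuous_of_mem S hp,
      fun a b => (hrp _).trans (hS.subset hp a b)⟩
  continuous_neg := continuous_neg

theorem submul_sup {p q : Seminorm ℂ A} (hp : p ∈ submulSeminorms A)
    (hq : q ∈ submulSeminorms A) : p ⊔ q ∈ submulSeminorms A := fun a b => by
  simp only [Seminorm.sup_apply]
  exact max_le
    ((hp a b).trans (mul_le_mul (le_max_left _ _) (le_max_left _ _) (by simp) (by simp)))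
    ((hq a b).trans (mul_le_mul (le_max_right _ _) (le_max_right _ _) (by simp) (by simp)))

theorem submul_smul {p : Seminorm ℂ A} (hp : p ∈ submulSeminorms A) {C : NNReal} (hC : 1 ≤ C) :
    C • p ∈ submulSeminorms A := fun a b => by
  simp only [smul_apply, NNReal.smul_def, smul_eq_mul]
  have h1 : (1 : ℝ) ≤ C := by exact_mod_cast hC
  have h2 : 0 ≤ p a * p b := mul_nonneg (apply_nonneg _ _) (apply_nonneg _ _)
  have h3 := hp a b
  calc (C : ℝ) * p (a * b) ≤ C * (p a * p b) := by gcongr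
    _ ≤ C * (C * (p a * p b)) := 
      mul_le_mul_of_nonneg_left (le_mul_of_one_le_left h2 h1) C.2
    _ = _ := by ring

instance : SubmulFamily (submulSeminorms A) where
  subset := subset_rfl
  saturated :=
    { bot_mem := fun a b => by simp
      sup_mem := fun _ hp _ hq => submul_sup hp hq
      smul_mem := fun _ hp _ hC => submul_smul hp hC }

/-- The algebra `A` with the topology given by all submultiplicative seminorms. -/
abbrev AMTop (A : Type*) [Ring A] [Algebra ℂ A] : Type _ := SemTop A (submulSeminorms A)

/-- The Arens-Michael envelope of an algebra `A`: the Hausdorff completion of `A` with respect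
to the family of all submultiplicative seminorms. -/
abbrev AMEnvelope (A : Type*) [Ring A] [Algebra ℂ A] : Type _ := Completion (AMTop A)

/-- The canonical homomorphism from an algebra to its Arens-Michael envelope. -/
def toAMEnvelope (A : Type*) [Ring A] [Algebra ℂ A] : A →ₐ[ℂ] AMEnvelope A where
  toFun a := ((show AMTop A from a) : AMEnvelope A)
  map_one' := Completion.coe_one _
  map_mul' a b := Completion.coe_mul (α := AMTop A) a b
  map_zero' := Completion.coe_zero
  map_add' a b := Completion.coe_add (α := AMTop A) a b
  commutes' _ := rfl

end Submul

/-! ### Module algebras and smash products -/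

section Smash

open Coalgebra

/-- An `H`-module algebra structure on `A`: an action of the algebra `H` on the vector space `A`
for which the unit `ℂ → A` and the product `A ⊗ A → A` are morphisms of `H`-modules. -/
structure ModuleAlgebra (H A : Type*) [Ring H] [Bialgebra ℂ H] [Ring A] [Algebra ℂ A] where
  act : H →ₐ[ℂ] Module.End ℂ A
  act_one : ∀ h : H, act h 1 = counit (R := ℂ) h • (1 : A)
  act_mul : ∀ (h : H) (a b : A), act h (a * b) = LinearMap.mul' ℂ A
    (TensorProduct.map (act.toLinearMap.flip a) (act.toLinearMap.flip b) (comul (R := ℂ) h))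

variable {H A : Type*} [Ring H] [Bialgebra ℂ H] [Ring A] [Algebra ℂ A]

namespace ModuleAlgebra

variable (ρ : ModuleAlgebra H A)

/-- The action as a map `H ⊗ A → A`. -/
def actionMap : H ⊗[ℂ] A →ₗ[ℂ] A := TensorProduct.lift ρ.act.toLinearMap

/-- The map `τ : H ⊗ A → A ⊗ H`, `τ (h ⊗ a) = ∑ h₍₁₎ • a ⊗ h₍₂₎`. -/
def tau : H ⊗[ℂ] A →ₗ[ℂ] A ⊗[ℂ] H :=
  TensorProduct.map ρ.actionMap LinearMap.id ∘ₗ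
  (TensorProduct.assoc ℂ H A H).symm.toLinearMap ∘ₗ
  TensorProduct.map LinearMap.id (TensorProduct.comm ℂ H A).toLinearMap ∘ₗ
  (TensorProduct.assoc ℂ H H A).toLinearMap ∘ₗ
  TensorProduct.map (comul (R := ℂ) (A := H)) LinearMap.id

/-- The multiplication of the smash product. -/
def smashMul : (A ⊗[ℂ] H) ⊗[ℂ] (A ⊗[ℂ] H) →ₗ[ℂ] A ⊗[ℂ] H :=
  TensorProduct.map (LinearMap.mul' ℂ A) (LinearMap.mul' ℂ H) ∘ₗ
  (TensorProduct.assoc ℂ A A (H ⊗[ℂ] H)).symm.toLinearMap ∘ₗ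
  TensorProduct.map LinearMap.id (TensorProduct.assoc ℂ A H H).toLinearMap ∘ₗ
  TensorProduct.map LinearMap.id (TensorProduct.map ρ.tau LinearMap.id) ∘ₗ
  TensorProduct.map LinearMap.id (TensorProduct.assoc ℂ H A H).symm.toLinearMap ∘ₗ
  (TensorProduct.assoc ℂ A H (A ⊗[ℂ] H)).toLinearMap

theorem tau_tmul (h : H) (a : A) :
    ρ.tau (h ⊗ₜ a) =
      TensorProduct.map (ρ.act.toLinearMap.flip a) LinearMap.id (comul (R := ℂ) h) := by
  simp only [tau, LinearMap.comp_apply, TensorProduct.map_tmul, LinearMap.id_apply]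
  induction comul (R := ℂ) h using TensorProduct.induction_on with
  | zero => simp
  | tmul x y => simp [actionMap]
  | add x y hx hy => simp only [TensorProduct.add_tmul, map_add, hx, hy]

theorem smashMul_tmul' (a b : A) (h k : H) :
    ρ.smashMul ((a ⊗ₜ h) ⊗ₜ (b ⊗ₜ k)) =
      TensorProduct.map (LinearMap.mulLeft ℂ a) (LinearMap.mulRight ℂ k) (ρ.tau (h ⊗ₜ b)) := by
  simp only [smashMul, LinearMap.comp_apply, TensorProduct.map_tmul, LinearMap.id_apply,
    LinearEquiv.coe_coe, TensorProduct.assoc_tmul, TensorProduct.assoc_symm_tmul]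
  induction ρ.tau (h ⊗ₜ b) using TensorProduct.induction_on with
  | zero => simp
  | tmul x y => simp
  | add x y hx hy => simp only [TensorProduct.add_tmul, TensorProduct.tmul_add, map_add, hx, hy]

theorem smashMul_tmul (a b : A) (h k : H) :
    ρ.smashMul ((a ⊗ₜ h) ⊗ₜ (b ⊗ₜ k)) =
      TensorProduct.map (LinearMap.mulLeft ℂ a ∘ₗ ρ.act.toLinearMap.flip b)
        (LinearMap.mulRight ℂ k) (comul (R := ℂ) h) := by
  rw [smashMul_tmul', tau_tmul, ← LinearMap.comp_apply, ← TensorProduct.map_comp]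
  simp

theorem smashMul_one_left (u : A ⊗[ℂ] H) : ρ.smashMul (((1 : A) ⊗ₜ (1 : H)) ⊗ₜ u) = u := by
  induction u using TensorProduct.induction_on with
  | zero => simp
  | tmul a h => simp [smashMul_tmul, Algebra.TensorProduct.one_def]
  | add x y hx hy => simp only [TensorProduct.tmul_add, map_add, hx, hy]

theorem smashMul_one_right (u : A ⊗[ℂ] H) : ρ.smashMul (u ⊗ₜ ((1 : A) ⊗ₜ (1 : H))) = u := by
  induction u using TensorProduct.induction_on with
  | zero => simp
  | tmul a h =>
    rw [smashMul_tmul, ← (Coalgebra.Repr.arbitrary ℂ h).eq]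
    simp only [map_sum, TensorProduct.map_tmul, LinearMap.comp_apply, LinearMap.flip_apply,
      LinearMap.mulLeft_apply, LinearMap.mulRight_apply, AlgHom.toLinearMap_apply, ρ.act_one,
      mul_one, mul_smul_comm, TensorProduct.smul_tmul, ← TensorProduct.tmul_sum]
    rw [Coalgebra.sum_counit_smul]
  | add x y hx hy => simp only [TensorProduct.add_tmul, map_add, hx, hy]

/-- The map `x ⊗ (y ⊗ z) ↦ a (x • b) (y • d) ⊗ z m`. -/
def assocMap (a b d : A) (m : H) : H ⊗[ℂ] (H ⊗[ℂ] H) →ₗ[ℂ] A ⊗[ℂ] H :=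
  TensorProduct.map
    (LinearMap.mul' ℂ A ∘ₗ TensorProduct.map
      (LinearMap.mulLeft ℂ a ∘ₗ ρ.act.toLinearMap.flip b) (ρ.act.toLinearMap.flip d))
    (LinearMap.mulRight ℂ m) ∘ₗ (TensorProduct.assoc ℂ H H H).symm.toLinearMap

theorem assocMap_left (a b d : A) (m : H) (k₁ : H) (x : H) (z : H ⊗[ℂ] H) (k₂ : H) :
    ρ.assocMap a b (ρ.act k₁ d) (k₂ * m) (x ⊗ₜ z) =
      TensorProduct.map (LinearMap.mulLeft ℂ (a * ρ.act x b) ∘ₗ ρ.act.toLinearMap.flip d)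
        (LinearMap.mulRight ℂ m) (z * (k₁ ⊗ₜ k₂)) := by
  induction z using TensorProduct.induction_on with
  | zero => simp
  | tmul y z => simp [assocMap, mul_assoc]
  | add y z hy hz => simp only [TensorProduct.tmul_add, map_add, add_mul, hy, hz]

theorem assocMap_right (a b d : A) (m : H) (z : H ⊗[ℂ] H) (y : H) :
    ρ.assocMap a b d m (TensorProduct.assoc ℂ H H H (z ⊗ₜ y)) =
      (a * LinearMap.mul' ℂ A (TensorProduct.map (ρ.act.toLinearMap.flip b)
        (ρ.act.toLinearMap.flip d) z)) ⊗ₜ (y * m) := by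
  induction z using TensorProduct.induction_on with
  | zero => simp
  | tmul x z => simp [assocMap, mul_assoc]
  | add x z hx hz => simp only [TensorProduct.add_tmul, map_add, mul_add, hx, hz]

theorem smashMul_assoc (u v w : A ⊗[ℂ] H) :
    ρ.smashMul (ρ.smashMul (u ⊗ₜ v) ⊗ₜ w) = ρ.smashMul (u ⊗ₜ ρ.smashMul (v ⊗ₜ w)) := by
  induction u using TensorProduct.induction_on with
  | zero => simp
  | add x y hx hy => simp only [TensorProduct.add_tmul, map_add, hx, hy]
  | tmul a h =>
  induction v using TensorProduct.induction_on with
  | zero => simp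
  | add x y hx hy => simp only [TensorProduct.add_tmul, TensorProduct.tmul_add, map_add, hx, hy]
  | tmul b k =>
  induction w using TensorProduct.induction_on with
  | zero => simp
  | add x y hx hy => simp only [TensorProduct.tmul_add, map_add, hx, hy]
  | tmul c l =>
  rw [smashMul_tmul, smashMul_tmul ρ b c k l]
  have hk := (Coalgebra.Repr.arbitrary ℂ k).eq
  set R := Coalgebra.Repr.arbitrary ℂ k
  -- the left-hand side, as a function of `comul h`
  have hL : ∀ z : H ⊗[ℂ] H, ρ.smashMul (TensorProduct.map
      (LinearMap.mulLeft ℂ a ∘ₗ ρ.act.toLinearMap.flip b) (LinearMap.mulRight ℂ k) z ⊗ₜ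
        (c ⊗ₜ[ℂ] l)) = ∑ i ∈ R.index,
      ρ.assocMap a b (ρ.act (R.left i) c) (R.right i * l)
        ((comul (R := ℂ) (A := H)).lTensor H z) := by
    intro z
    induction z using TensorProduct.induction_on with
    | zero => simp
    | tmul x y =>
      simp only [TensorProduct.map_tmul, LinearMap.comp_apply, LinearMap.mulLeft_apply,
        LinearMap.mulRight_apply, LinearMap.flip_apply, AlgHom.toLinearMap_apply, smashMul_tmul,
        LinearMap.lTensor_tmul, assocMap_left, Bialgebra.comul_mul]
      rw [← map_sum, ← Finset.mul_sum, hk]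
    | add y z hy hz =>
      simp only [map_add, TensorProduct.add_tmul, hy, hz, Finset.sum_add_distrib]
  -- the right-hand side, as a function of `comul h`
  have hR : ∀ (d : A) (m : H) (z : H ⊗[ℂ] H), TensorProduct.map
      (LinearMap.mulLeft ℂ a ∘ₗ ρ.act.toLinearMap.flip (b * d)) (LinearMap.mulRight ℂ m) z =
      ρ.assocMap a b d m (TensorProduct.assoc ℂ H H H
        ((comul (R := ℂ) (A := H)).rTensor H z)) := by
    intro d m z
    induction z using TensorProduct.induction_on with
    | zero => simp
    | tmul x y =>
      simp only [TensorProduct.map_tmul, LinearMap.comp_apply, LinearMap.mulLeft_apply,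
        LinearMap.mulRight_apply, LinearMap.flip_apply, AlgHom.toLinearMap_apply,
        LinearMap.rTensor_tmul, assocMap_right, ρ.act_mul]
    | add y z hy hz => simp only [map_add, hy, hz]
  rw [hL, ← hk]
  simp only [map_sum, TensorProduct.tmul_sum, TensorProduct.map_tmul, LinearMap.comp_apply,
    LinearMap.mulLeft_apply, LinearMap.mulRight_apply, LinearMap.flip_apply,
    AlgHom.toLinearMap_apply, smashMul_tmul, hR, Coalgebra.coassoc_apply]

theorem smashMul_smul_left (c : ℂ) (u v : A ⊗[ℂ] H) :
    ρ.smashMul ((c • u) ⊗ₜ v) = c • ρ.smashMul (u ⊗ₜ v) := by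
  rw [← map_smul, TensorProduct.smul_tmul']

theorem smashMul_smul_right (c : ℂ) (u v : A ⊗[ℂ] H) :
    ρ.smashMul (u ⊗ₜ (c • v)) = c • ρ.smashMul (u ⊗ₜ v) := by
  rw [← map_smul, TensorProduct.tmul_smul]

/-- The smash product `A # H`. -/
def Smash (_ρ : ModuleAlgebra H A) : Type _ := A ⊗[ℂ] H

instance : AddCommGroup ρ.Smash := inferInstanceAs (AddCommGroup (A ⊗[ℂ] H))
instance : Module ℂ ρ.Smash := inferInstanceAs (Module ℂ (A ⊗[ℂ] H))

instance : Ring ρ.Smash where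
  __ := (inferInstance : AddCommGroup ρ.Smash)
  mul u v := ρ.smashMul (u ⊗ₜ v)
  one := (1 : A) ⊗ₜ[ℂ] (1 : H)
  left_distrib u v w := (congrArg ρ.smashMul (TensorProduct.tmul_add u v w)).trans (map_add _ _ _)
  right_distrib u v w := (congrArg ρ.smashMul (TensorProduct.add_tmul u v w)).trans (map_add _ _ _)
  zero_mul u := (congrArg ρ.smashMul (TensorProduct.zero_tmul _ u)).trans (map_zero _)
  mul_zero u := (congrArg ρ.smashMul (TensorProduct.tmul_zero _ u)).trans (map_zero _)
  mul_assoc := ρ.smashMul_assoc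
  one_mul := ρ.smashMul_one_left
  mul_one := ρ.smashMul_one_right

instance : Algebra ℂ ρ.Smash := Algebra.ofModule
  (fun c u v => ρ.smashMul_smul_left c u v) (fun c u v => ρ.smashMul_smul_right c u v)

/-- The element `a ⊗ h` of the smash product. -/
def smashTmul (a : A) (h : H) : ρ.Smash := a ⊗ₜ[ℂ] h

end ModuleAlgebra
end Smash

/-! ### The `H`-completion and the analytic smash product -/

section Analytic

open Coalgebra

/-- The multiplication `𝒜 ⊗̂ 𝒜 → 𝒜` of a complete locally convex algebra. -/
def mulHat (𝒜 : Type*) [Ring 𝒜] [Algebra ℂ 𝒜] [UniformSpace 𝒜] [CompleteLCS 𝒜]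
    [IsTopologicalRing 𝒜] : CTP 𝒜 𝒜 →L[ℂ] 𝒜 :=
  CTP.lift ⟨LinearMap.mul ℂ 𝒜, continuous_mul⟩

theorem mulHat_mk {𝒜 : Type*} [Ring 𝒜] [Algebra ℂ 𝒜] [UniformSpace 𝒜] [CompleteLCS 𝒜]
    [IsTopologicalRing 𝒜] (x y : 𝒜) : mulHat 𝒜 (CTP.mk x y) = x * y := CTP.lift_mk _ _ _

section General

variable {𝒜 ℋ : Type*} [Ring 𝒜] [Algebra ℂ 𝒜] [UniformSpace 𝒜] [CompleteLCS 𝒜]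
  [IsTopologicalRing 𝒜] [Ring ℋ] [Algebra ℂ ℋ] [UniformSpace ℋ] [CompleteLCS ℋ]
  [IsTopologicalRing ℋ]

/-- The map `τ : ℋ ⊗̂ 𝒜 → 𝒜 ⊗̂ ℋ` given by a comultiplication and an action. -/
def tauHat (Δ : ℋ →L[ℂ] CTP ℋ ℋ) (act : CTP ℋ 𝒜 →L[ℂ] 𝒜) : CTP ℋ 𝒜 →L[ℂ] CTP 𝒜 ℋ :=
  CTP.map act (.id ℂ ℋ) ∘L
  CTP.assocSymm ℋ 𝒜 ℋ ∘L
  CTP.map (.id ℂ ℋ) (CTP.comm ℋ 𝒜) ∘L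
  CTP.assoc ℋ ℋ 𝒜 ∘L
  CTP.map Δ (.id ℂ 𝒜)

/-- The multiplication of the analytic smash product, given by a comultiplication and an
action. -/
def smashMulHat (Δ : ℋ →L[ℂ] CTP ℋ ℋ) (act : CTP ℋ 𝒜 →L[ℂ] 𝒜) :
    CTP (CTP 𝒜 ℋ) (CTP 𝒜 ℋ) →L[ℂ] CTP 𝒜 ℋ :=
  CTP.map (mulHat 𝒜) (mulHat ℋ) ∘L
  CTP.assocSymm 𝒜 𝒜 (CTP ℋ ℋ) ∘L
  CTP.map (.id ℂ 𝒜) (CTP.assoc 𝒜 ℋ ℋ) ∘L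
  CTP.map (.id ℂ 𝒜) (CTP.map (tauHat Δ act) (.id ℂ ℋ)) ∘L
  CTP.map (.id ℂ 𝒜) (CTP.assocSymm ℋ 𝒜 ℋ) ∘L
  CTP.assoc 𝒜 ℋ (CTP 𝒜 ℋ)

end General

theorem projSeminorm_submul {A B : Type*} [Ring A] [Algebra ℂ A] [Ring B] [Algebra ℂ B]
    {p : Seminorm ℂ A} {q : Seminorm ℂ B}
    (hp : p ∈ submulSeminorms A) (hq : q ∈ submulSeminorms B) :
    projSeminorm p q ∈ submulSeminorms (A ⊗[ℂ] B) := by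
  have h1 : ∀ (a : A) (b : B) (v : A ⊗[ℂ] B), projSeminorm p q ((a ⊗ₜ b) * v) ≤
      (p a * q b) * projSeminorm p q v := by
    intro a b v
    refine le_projSeminorm (r := (projSeminorm p q).comp (LinearMap.mulLeft ℂ (a ⊗ₜ b)))
      (mul_nonneg (apply_nonneg _ _) (apply_nonneg _ _)) (fun e f => ?_) v
    simp only [Seminorm.comp_apply, LinearMap.mulLeft_apply, Algebra.TensorProduct.tmul_mul_tmul]
    calc _ ≤ p (a * e) * q (b * f) := projSeminorm_tmul_le _ _ _ _
      _ ≤ (p a * p e) * (q b * q f) := mul_le_mul (hp _ _) (hq _ _) (apply_nonneg _ _)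
          (mul_nonneg (apply_nonneg _ _) (apply_nonneg _ _))
      _ = _ := by ring
  intro u v
  rw [mul_comm (projSeminorm p q u)]
  refine le_projSeminorm (r := (projSeminorm p q).comp (LinearMap.mulRight ℂ v))
    (apply_nonneg _ _) (fun e f => ?_) u
  rw [mul_comm]
  exact h1 e f v

variable {H A : Type*} [Ring H] [Bialgebra ℂ H] [Ring A] [Algebra ℂ A]

theorem continuous_comul_aux : Continuous (fun h : AMTop H =>
    CTP.ofTensor (AMEnvelope H) (AMEnvelope H)
      (TensorProduct.map (toAMEnvelope H).toLinearMap (toAMEnvelope H).toLinearMap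
        (comul (R := ℂ) (A := H) h))) := by
  refine WithSeminorms.continuous_of_continuous_comp
    (PolynormableSpace.withSeminorms ℂ (CTP (AMEnvelope H) (AMEnvelope H)))
    (show AMTop H →ₗ[ℂ] CTP (AMEnvelope H) (AMEnvelope H) from
      CTP.ofTensor (AMEnvelope H) (AMEnvelope H) ∘ₗ
      TensorProduct.map (toAMEnvelope H).toLinearMap (toAMEnvelope H).toLinearMap ∘ₗ
      comul (R := ℂ) (A := H)) fun r => ?_
  obtain ⟨p, q, hp, hq, h⟩ := (CTP.tmul (AMEnvelope H) (AMEnvelope H)).exists_bound r.1 r.2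
  have hS : SemTop.Saturated (submulSeminorms H) := SubmulFamily.saturated
  obtain ⟨p', hp', hpp'⟩ := hS.exists_le (p.comp (toCompl (AMTop H)).toLinearMap)
    (hp.comp (toCompl (AMTop H)).continuous)
  obtain ⟨q', hq', hqq'⟩ := hS.exists_le (q.comp (toCompl (AMTop H)).toLinearMap)
    (hq.comp (toCompl (AMTop H)).continuous)
  have hm : (projSeminorm p' q').comp (comul (R := ℂ) (A := H)) ∈ submulSeminorms H := by
    intro a b
    simp only [Seminorm.comp_apply, Bialgebra.comul_mul]
    exact projSeminorm_submul hp' hq' _ _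
  refine Seminorm.continuous_of_le
    (q := (show Seminorm ℂ (AMTop H) from (projSeminorm p' q').comp (comul (R := ℂ) (A := H))))
    (SemTop.continuous_of_mem _ hm) fun x => ?_
  have := le_projSeminorm (p := p') (q := q') (C := 1)
    (r := r.1.comp (CTP.ofTensor (AMEnvelope H) (AMEnvelope H) ∘ₗ
      TensorProduct.map (toAMEnvelope H).toLinearMap (toAMEnvelope H).toLinearMap)) zero_le_one
    (fun e f => by
      rw [one_mul]
      exact (h _ _).trans (mul_le_mul (hpp' e) (hqq' f) (apply_nonneg _ _) (apply_nonneg _ _)))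
    (comul (R := ℂ) (A := H) x)
  rw [one_mul] at this
  exact this

/-- The comultiplication `Ĥ → Ĥ ⊗̂ Ĥ` of the Arens-Michael envelope of a bialgebra: the
continuous extension of the comultiplication of `H`. -/
def comulHat (H : Type*) [Ring H] [Bialgebra ℂ H] :
    AMEnvelope H →L[ℂ] CTP (AMEnvelope H) (AMEnvelope H) :=
  ContinuousLinearMap.extend
    (⟨(show AMTop H →ₗ[ℂ] CTP (AMEnvelope H) (AMEnvelope H) from
      CTP.ofTensor (AMEnvelope H) (AMEnvelope H) ∘ₗ
      TensorProduct.map (toAMEnvelope H).toLinearMap (toAMEnvelope H).toLinearMap ∘ₗ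
      comul (R := ℂ) (A := H)), continuous_comul_aux⟩ :
      AMTop H →L[ℂ] CTP (AMEnvelope H) (AMEnvelope H))
    (toCompl (AMTop H))

theorem comulHat_coe (h : H) : comulHat H (toAMEnvelope H h) =
    CTP.ofTensor (AMEnvelope H) (AMEnvelope H)
      (TensorProduct.map (toAMEnvelope H).toLinearMap (toAMEnvelope H).toLinearMap
        (comul (R := ℂ) h)) :=
  ContinuousLinearMap.extend_eq _ denseRange_toCompl isUniformInducing_toCompl
    (show AMTop H from h)

namespace ModuleAlgebra

variable (ρ : ModuleAlgebra H A)

/-- The `H`-stable submultiplicative seminorms on an `H`-module algebra. -/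
def stableSeminorms : Set (Seminorm ℂ A) :=
  {p | p ∈ submulSeminorms A ∧ ∀ h : H, ∃ C : ℝ, 0 < C ∧ ∀ a : A, p (ρ.act h a) ≤ C * p a}

instance : SubmulFamily ρ.stableSeminorms where
  subset := fun _ hp => hp.1
  saturated :=
    { bot_mem := ⟨fun a b => by simp, fun h => ⟨1, one_pos, fun a => by simp⟩⟩
      sup_mem := fun p hp q hq => ⟨submul_sup hp.1 hq.1, fun h => by
        obtain ⟨C, hC, h1⟩ := hp.2 h
        obtain ⟨D, hD, h2⟩ := hq.2 h
        refine ⟨max C D, lt_max_of_lt_left hC, fun a => ?_⟩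
        simp only [Seminorm.sup_apply]
        exact max_le ((h1 a).trans (mul_le_mul (le_max_left _ _) (le_max_left _ _) (by simp)
            (hC.le.trans (le_max_left _ _))))
          ((h2 a).trans (mul_le_mul (le_max_right _ _) (le_max_right _ _) (by simp)
            (hC.le.trans (le_max_left _ _))))⟩
      smul_mem := fun p hp C hC => ⟨submul_smul hp.1 hC, fun h => by
        obtain ⟨D, hD, h1⟩ := hp.2 h
        refine ⟨D, hD, fun a => ?_⟩
        simp only [smul_apply, NNReal.smul_def, smul_eq_mul]
        calc (C : ℝ) * p (ρ.act h a) ≤ C * (D * p a) := by gcongr; exact h1 a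
          _ = _ := by ring⟩ }

/-- The algebra `A` with the topology given by the `H`-stable submultiplicative seminorms. -/
abbrev StableTop : Type _ := SemTop A ρ.stableSeminorms

/-- The `H`-completion `Ã` of an `H`-module algebra `A`. -/
abbrev HCompletion : Type _ := Completion ρ.StableTop

/-- The canonical homomorphism `A → Ã`. -/
def toHCompletion : A →ₐ[ℂ] ρ.HCompletion where
  toFun a := ((show ρ.StableTop from a) : ρ.HCompletion)
  map_one' := Completion.coe_one _
  map_mul' a b := Completion.coe_mul (α := ρ.StableTop) a b
  map_zero' := Completion.coe_zero
  map_add' a b := Completion.coe_add (α := ρ.StableTop) a b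
  commutes' _ := rfl

/-- The operator seminorm on `H` defined by a stable seminorm on `A`. -/
def opSeminorm (p : Seminorm ℂ A) : Seminorm ℂ H :=
  ⨆ a : {a : A // p a ≤ 1}, p.comp (ρ.act.toLinearMap.flip a.1)

variable {ρ} in
theorem bddAbove_opSeminorm {p : Seminorm ℂ A} (hp : p ∈ ρ.stableSeminorms) :
    BddAbove (Set.range fun a : {a : A // p a ≤ 1} => p.comp (ρ.act.toLinearMap.flip a.1)) := by
  rw [Seminorm.bddAbove_range_iff]
  intro h
  obtain ⟨C, hC, hb⟩ := hp.2 h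
  refine ⟨C, ?_⟩
  rintro _ ⟨a, rfl⟩
  exact (hb a.1).trans (mul_le_of_le_one_right hC.le a.2)

variable {ρ} in
theorem le_opSeminorm {p : Seminorm ℂ A} (hp : p ∈ ρ.stableSeminorms) (h : H) (a : A) :
    p (ρ.act h a) ≤ ρ.opSeminorm p h * p a := by
  rcases (apply_nonneg p a).eq_or_lt with h0 | h0
  · obtain ⟨C, -, hb⟩ := hp.2 h
    have := hb a
    rw [← h0, mul_zero] at this ⊢
    exact this
  · have hn : ‖(((p a)⁻¹ : ℝ) : ℂ)‖ = (p a)⁻¹ := by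
      rw [Complex.norm_real, Real.norm_of_nonneg (by positivity)]
    have h1 := le_ciSup (bddAbove_opSeminorm hp) ⟨(((p a)⁻¹ : ℝ) : ℂ) • a, by
      rw [map_smul_eq_mul, hn, inv_mul_cancel₀ h0.ne']⟩ h
    have h2 : p (ρ.act h ((((p a)⁻¹ : ℝ) : ℂ) • a)) ≤ ρ.opSeminorm p h := h1
    rw [map_smul, map_smul_eq_mul, hn, inv_mul_le_iff₀ h0] at h2
    linarith

variable {ρ} in
theorem opSeminorm_submul {p : Seminorm ℂ A} (hp : p ∈ ρ.stableSeminorms) :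
    ρ.opSeminorm p ∈ submulSeminorms H := by
  intro g h
  rw [opSeminorm, Seminorm.iSup_apply (bddAbove_opSeminorm hp)]
  refine Real.iSup_le (fun a => ?_) (mul_nonneg (apply_nonneg _ _) (apply_nonneg _ _))
  simp only [Seminorm.comp_apply, LinearMap.flip_apply, AlgHom.toLinearMap_apply, map_mul,
    Module.End.mul_apply]
  calc _ ≤ ρ.opSeminorm p g * p (ρ.act h a.1) := le_opSeminorm hp _ _
    _ ≤ ρ.opSeminorm p g * (ρ.opSeminorm p h * p a.1) := by gcongr; exact le_opSeminorm hp _ _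
    _ ≤ ρ.opSeminorm p g * (ρ.opSeminorm p h * 1) := by gcongr; exact a.2
    _ = _ := by rw [mul_one]; rfl

/-- The action `H × A → Ã`. -/
def actionBilin : CBilin (AMTop H) ρ.StableTop ρ.HCompletion where
  toBilin := (show AMTop H →ₗ[ℂ] ρ.StableTop →ₗ[ℂ] ρ.StableTop from
    ρ.act.toLinearMap).compr₂ (toCompl ρ.StableTop).toLinearMap
  cont := by
    refine (toCompl ρ.StableTop).continuous.comp (continuous_of_bound
      (show AMTop H →ₗ[ℂ] ρ.StableTop →ₗ[ℂ] ρ.StableTop from ρ.act.toLinearMap) fun r hr => ?_)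
    have hS : SemTop.Saturated ρ.stableSeminorms := SubmulFamily.saturated
    obtain ⟨p, hp, hrp⟩ := hS.exists_le r hr
    exact ⟨ρ.opSeminorm p, p, SemTop.continuous_of_mem _ (opSeminorm_submul hp),
      SemTop.continuous_of_mem _ hp, fun h a => (hrp _).trans (le_opSeminorm hp h a)⟩

/-- The action `Ĥ ⊗̂ Ã → Ã`: the continuous extension of the action of `H` on `A`. -/
def actionHat : CTP (AMEnvelope H) ρ.HCompletion →L[ℂ] ρ.HCompletion :=
  CTP.lift (ρ.actionBilin.extend (toCompl (AMTop H)) (toCompl ρ.StableTop)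
    isDenseInducing_toCompl isDenseInducing_toCompl)

theorem actionHat_coe (h : H) (a : A) :
    ρ.actionHat (CTP.mk (toAMEnvelope H h) (ρ.toHCompletion a)) =
      ρ.toHCompletion (ρ.act h a) := by
  rw [actionHat, CTP.lift_mk]
  exact CBilin.extend_apply _ _ _ _ _ (show AMTop H from h) (show ρ.StableTop from a)

end ModuleAlgebra
end Analytic

section Dense

theorem dense_assoc {V X : Type*} [TopologicalSpace X] [T2Space X] (j : V → X) (hj : DenseRange j)
    (m : X → X → X) (hm : Continuous fun z : X × X => m z.1 z.2) (n : V → V → V)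
    (h : ∀ u v, m (j u) (j v) = j (n u v))
    (hn : ∀ u v w, n (n u v) w = n u (n v w)) (x y z : X) :
    m (m x y) z = m x (m y z) := by
  have h2 : ∀ {Y : Type _} [TopologicalSpace Y] {f g : Y → X}, Continuous f → Continuous g →
      Continuous fun y => m (f y) (g y) := fun hf hg => hm.comp (hf.prodMk hg)
  refine hj.induction_on₃ (p := fun x y z => m (m x y) z = m x (m y z)) ?_ ?_ x y z
  · exact isClosed_eq (h2 (h2 (by fun_prop) (by fun_prop)) (by fun_prop))
      (h2 (by fun_prop) (h2 (by fun_prop) (by fun_prop)))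
  · intro u v w
    rw [h, h, h, h, hn]

theorem dense_one_left {V X : Type*} [TopologicalSpace X] [T2Space X] (j : V → X) (hj : DenseRange j)
    (m : X → X → X) (hm : Continuous fun z : X × X => m z.1 z.2) (n : V → V → V)
    (h : ∀ u v, m (j u) (j v) = j (n u v))
    (e : V) {x₁ : X} (he : j e = x₁) (hn : ∀ u, n e u = u) (x : X) :
    m x₁ x = x :=
  hj.induction_on (p := fun x => m x₁ x = x) x
    (isClosed_eq (hm.comp (continuous_const.prodMk continuous_id)) continuous_id)
    fun u => by rw [← he, h, hn]

theorem dense_one_right {V X : Type*} [TopologicalSpace X] [T2Space X] (j : V → X) (hj : DenseRange j)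
    (m : X → X → X) (hm : Continuous fun z : X × X => m z.1 z.2) (n : V → V → V)
    (h : ∀ u v, m (j u) (j v) = j (n u v))
    (e : V) {x₁ : X} (he : j e = x₁) (hn : ∀ u, n u e = u) (x : X) :
    m x x₁ = x :=
  hj.induction_on (p := fun x => m x x₁ = x) x
    (isClosed_eq (hm.comp (continuous_id.prodMk continuous_const)) continuous_id)
    fun u => by rw [← he, h, hn]

end Dense

section AnalyticSmash

open Coalgebra

variable {H A : Type*} [Ring H] [Bialgebra ℂ H] [Ring A] [Algebra ℂ A]

namespace ModuleAlgebra

variable (ρ : ModuleAlgebra H A)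

/-- The analytic smash product `Ã #̂ Ĥ`, as a locally convex space equal to `Ã ⊗̂ Ĥ`. -/
def AnalyticSmash : Type _ := CTP ρ.HCompletion (AMEnvelope H)

instance : AddCommGroup ρ.AnalyticSmash :=
  inferInstanceAs (AddCommGroup (CTP ρ.HCompletion (AMEnvelope H)))
instance : Module ℂ ρ.AnalyticSmash :=
  inferInstanceAs (Module ℂ (CTP ρ.HCompletion (AMEnvelope H)))
instance : UniformSpace ρ.AnalyticSmash :=
  inferInstanceAs (UniformSpace (CTP ρ.HCompletion (AMEnvelope H)))
instance : CompleteLCS ρ.AnalyticSmash :=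
  inferInstanceAs (CompleteLCS (CTP ρ.HCompletion (AMEnvelope H)))

/-- The multiplication `(Ã ⊗̂ Ĥ) × (Ã ⊗̂ Ĥ) → Ã ⊗̂ Ĥ` of the analytic smash product. -/
def analyticMul (u v : CTP ρ.HCompletion (AMEnvelope H)) : CTP ρ.HCompletion (AMEnvelope H) :=
  smashMulHat (comulHat H) ρ.actionHat (CTP.mk u v)

/-- The canonical linear map `A ⊗ H → Ã ⊗̂ Ĥ`. -/
def canLin : A ⊗[ℂ] H →ₗ[ℂ] CTP ρ.HCompletion (AMEnvelope H) :=
  CTP.ofTensor ρ.HCompletion (AMEnvelope H) ∘ₗ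
    TensorProduct.map ρ.toHCompletion.toLinearMap (toAMEnvelope H).toLinearMap

theorem canLin_tmul (a : A) (h : H) :
    ρ.canLin (a ⊗ₜ h) = CTP.mk (ρ.toHCompletion a) (toAMEnvelope H h) := rfl

theorem tauHat_coe (h : H) (b : A) :
    tauHat (comulHat H) ρ.actionHat (CTP.mk (toAMEnvelope H h) (ρ.toHCompletion b)) =
      ρ.canLin (ρ.tau (h ⊗ₜ b)) := by
  simp only [tauHat, ContinuousLinearMap.comp_apply, CTP.map_mk, comulHat_coe, tau_tmul,
    ContinuousLinearMap.id_apply]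
  induction comul (R := ℂ) h using TensorProduct.induction_on with
  | zero => simp [CTP.zero_mk, CTP.mk_zero]
  | tmul x y =>
    simp only [TensorProduct.map_tmul, CTP.ofTensor_tmul, AlgHom.toLinearMap_apply, CTP.assoc_mk,
      CTP.map_mk, ContinuousLinearMap.id_apply, CTP.comm_mk, CTP.assocSymm_mk, actionHat_coe,
      canLin_tmul, LinearMap.flip_apply, LinearMap.id_apply]
  | add x y hx hy => simp only [map_add, CTP.add_mk, CTP.mk_add, hx, hy]

theorem analyticMul_coe (u v : A ⊗[ℂ] H) :
    ρ.analyticMul (ρ.canLin u) (ρ.canLin v) = ρ.canLin (ρ.smashMul (u ⊗ₜ v)) := by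
  unfold analyticMul
  induction u using TensorProduct.induction_on with
  | zero => simp [CTP.zero_mk, CTP.mk_zero]
  | add x y hx hy =>
    simp only [map_add, CTP.add_mk, TensorProduct.add_tmul, hx, hy]
  | tmul a h =>
  induction v using TensorProduct.induction_on with
  | zero => simp [CTP.zero_mk, CTP.mk_zero]
  | add x y hx hy => simp only [map_add, CTP.mk_add, TensorProduct.tmul_add, hx, hy]
  | tmul b k =>
  simp only [smashMulHat, ContinuousLinearMap.comp_apply, canLin_tmul, CTP.map_mk, CTP.assoc_mk,
    CTP.assocSymm_mk, ContinuousLinearMap.id_apply, tauHat_coe, smashMul_tmul']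
  induction ρ.tau (h ⊗ₜ b) using TensorProduct.induction_on with
  | zero => simp [CTP.zero_mk, CTP.mk_zero]
  | tmul x y =>
    simp only [canLin_tmul, CTP.map_mk, CTP.assoc_mk, CTP.assocSymm_mk,
      ContinuousLinearMap.id_apply, mulHat_mk, TensorProduct.map_tmul, LinearMap.mulLeft_apply,
      LinearMap.mulRight_apply, map_mul]
  | add x y hx hy => simp only [map_add, CTP.add_mk, CTP.mk_add, hx, hy]

theorem continuous_analyticMul :
    Continuous fun z : CTP ρ.HCompletion (AMEnvelope H) × CTP ρ.HCompletion (AMEnvelope H) =>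
      ρ.analyticMul z.1 z.2 :=
  (smashMulHat (comulHat H) ρ.actionHat).continuous.comp (CTP.tmul _ _).cont

theorem denseRange_canLin : DenseRange ρ.canLin := by
  let N : Submodule ℂ (CTP ρ.HCompletion (AMEnvelope H)) :=
    (LinearMap.range ρ.canLin).topologicalClosure
  have h1 : ∀ (x : ρ.HCompletion) (y : AMEnvelope H), CTP.mk x y ∈ N := by
    intro x y
    have hc : IsClosed {z : ρ.HCompletion × AMEnvelope H | CTP.mk z.1 z.2 ∈ N} :=
      (Submodule.isClosed_topologicalClosure _).preimage (CTP.tmul _ _).cont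
    have hd : DenseRange (Prod.map (toCompl ρ.StableTop) (toCompl (AMTop H))) :=
      denseRange_toCompl.prodMap denseRange_toCompl
    exact hd.induction_on (p := fun z => CTP.mk z.1 z.2 ∈ N) (x, y) hc fun z =>
      Submodule.le_topologicalClosure _ ⟨(show A from z.1) ⊗ₜ (show H from z.2), rfl⟩
  have h2 : ∀ t, CTP.ofTensor ρ.HCompletion (AMEnvelope H) t ∈ N := by
    intro t
    induction t using TensorProduct.induction_on with
    | zero => simp
    | tmul x y => exact h1 x y
    | add x y hx hy => rw [map_add]; exact N.add_mem hx hy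
  intro x
  have h3 := CTP.denseRange_ofTensor ρ.HCompletion (AMEnvelope H) x
  have h4 : closure (Set.range (CTP.ofTensor ρ.HCompletion (AMEnvelope H))) ⊆ N :=
    closure_minimal (by rintro _ ⟨t, rfl⟩; exact h2 t) (Submodule.isClosed_topologicalClosure _)
  exact h4 h3

theorem analyticMul_assoc (u v w : CTP ρ.HCompletion (AMEnvelope H)) :
    ρ.analyticMul (ρ.analyticMul u v) w = ρ.analyticMul u (ρ.analyticMul v w) :=
  dense_assoc ρ.canLin ρ.denseRange_canLin ρ.analyticMul ρ.continuous_analyticMul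
    (fun u v => ρ.smashMul (u ⊗ₜ v)) ρ.analyticMul_coe ρ.smashMul_assoc u v w

theorem analyticMul_one_left (u : CTP ρ.HCompletion (AMEnvelope H)) :
    ρ.analyticMul (CTP.mk 1 1) u = u :=
  dense_one_left ρ.canLin ρ.denseRange_canLin ρ.analyticMul ρ.continuous_analyticMul
    (fun u v => ρ.smashMul (u ⊗ₜ v)) ρ.analyticMul_coe ((1 : A) ⊗ₜ (1 : H))
    (by rw [canLin_tmul, map_one, map_one]) ρ.smashMul_one_left u

theorem analyticMul_one_right (u : CTP ρ.HCompletion (AMEnvelope H)) :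
    ρ.analyticMul u (CTP.mk 1 1) = u :=
  dense_one_right ρ.canLin ρ.denseRange_canLin ρ.analyticMul ρ.continuous_analyticMul
    (fun u v => ρ.smashMul (u ⊗ₜ v)) ρ.analyticMul_coe ((1 : A) ⊗ₜ (1 : H))
    (by rw [canLin_tmul, map_one, map_one]) ρ.smashMul_one_right u

section
variable (u v w : CTP ρ.HCompletion (AMEnvelope H)) (c : ℂ)

theorem analyticMul_add :
    ρ.analyticMul u (v + w) = ρ.analyticMul u v + ρ.analyticMul u w := by
  simp only [analyticMul, CTP.mk_add, map_add]

theorem add_analyticMul :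
    ρ.analyticMul (u + v) w = ρ.analyticMul u w + ρ.analyticMul v w := by
  simp only [analyticMul, CTP.add_mk, map_add]

theorem zero_analyticMul : ρ.analyticMul 0 u = 0 := by
  simp only [analyticMul, CTP.zero_mk, map_zero]

theorem analyticMul_zero : ρ.analyticMul u 0 = 0 := by
  simp only [analyticMul, CTP.mk_zero, map_zero]

theorem smul_analyticMul : ρ.analyticMul (c • u) v = c • ρ.analyticMul u v := by
  simp only [analyticMul, CTP.smul_mk, map_smul]

theorem analyticMul_smul : ρ.analyticMul u (c • v) = c • ρ.analyticMul u v := by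
  simp only [analyticMul, CTP.mk_smul, map_smul]

end

instance : Ring ρ.AnalyticSmash where
  __ := (inferInstance : AddCommGroup ρ.AnalyticSmash)
  mul u v := ρ.analyticMul u v
  one := CTP.mk (1 : ρ.HCompletion) (1 : AMEnvelope H)
  left_distrib := ρ.analyticMul_add
  right_distrib := ρ.add_analyticMul
  zero_mul := ρ.zero_analyticMul
  mul_zero := ρ.analyticMul_zero
  mul_assoc := ρ.analyticMul_assoc
  one_mul := ρ.analyticMul_one_left
  mul_one := ρ.analyticMul_one_right

instance : Algebra ℂ ρ.AnalyticSmash := Algebra.ofModule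
  (fun c u v => ρ.smul_analyticMul u v c) (fun c u v => ρ.analyticMul_smul u v c)

instance : IsTopologicalRing ρ.AnalyticSmash where
  continuous_mul := ρ.continuous_analyticMul
  continuous_neg := continuous_neg

/-- The canonical homomorphism `A # H → Ã #̂ Ĥ`, `a ⊗ h ↦ a ⊗ h`. -/
def toAnalyticSmash : ρ.Smash →ₐ[ℂ] ρ.AnalyticSmash :=
  AlgHom.ofLinearMap (show ρ.Smash →ₗ[ℂ] ρ.AnalyticSmash from ρ.canLin)
    ((ρ.canLin_tmul 1 1).trans (by rw [map_one, map_one]; rfl))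
    (fun u v => (ρ.analyticMul_coe u v).symm)

end ModuleAlgebra
end AnalyticSmash

/-! ### The quantum plane -/

section QuantumPlane

/-- A monoid `G` acting on `A` by algebra endomorphisms makes `A` into a `ℂG`-module algebra. -/
def ModuleAlgebra.ofEndomorphisms {G A : Type*} [AddMonoid G] [Ring A] [Algebra ℂ A]
    (φ : Multiplicative G →* (A →ₐ[ℂ] A)) : ModuleAlgebra (AddMonoidAlgebra ℂ G) A where
  act := AddMonoidAlgebra.lift ℂ (Module.End ℂ A) G
    { toFun := fun g => (φ g).toLinearMap
      map_one' := by rw [map_one]; rfl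
      map_mul' := fun g g' => by rw [map_mul]; rfl }
  act_one h := by
    induction h using AddMonoidAlgebra.induction_linear with
    | zero => simp
    | add f g hf hg => simp only [map_add, LinearMap.add_apply, hf, hg, add_smul]
    | single g c => simp [AddMonoidAlgebra.lift_single]
  act_mul h a b := by
    induction h using AddMonoidAlgebra.induction_linear with
    | zero => simp
    | add f g hf hg => simp only [map_add, LinearMap.add_apply, hf, hg]
    | single g c => simp [AddMonoidAlgebra.lift_single]

/-- The action of the additive semigroup `ℤ₊` on `ℂ[x]` by `(k • f)(x) = f(q⁻ᵏ x)`, as a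
module algebra over the semigroup algebra `ℂℤ₊`. -/
def qAction (q : ℂ) : ModuleAlgebra (AddMonoidAlgebra ℂ ℕ) (Polynomial ℂ) :=
  ModuleAlgebra.ofEndomorphisms
    { toFun := fun k => Polynomial.aeval (Polynomial.C (q ^ k.toAdd)⁻¹ * Polynomial.X)
      map_one' := by ext; simp
      map_mul' := fun k l => by
        refine Polynomial.algHom_ext ?_
        simp only [toAdd_mul, pow_add, mul_inv, map_mul, Polynomial.aeval_X, AlgHom.mul_apply,
          Polynomial.aeval_C, Polynomial.algebraMap_eq]
        ring }

/-- The basis element `δ_k` of the semigroup algebra `ℂℤ₊`. -/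
def delta (k : ℕ) : AddMonoidAlgebra ℂ ℕ := AddMonoidAlgebra.single k 1

/-- The defining relation `x y = q y x` of the quantum plane, on the free algebra on
`x = ι 0` and `y = ι 1`. -/
inductive QuantumPlaneRel (q : ℂ) : FreeAlgebra ℂ (Fin 2) → FreeAlgebra ℂ (Fin 2) → Prop
  | rel : QuantumPlaneRel q (FreeAlgebra.ι ℂ 0 * FreeAlgebra.ι ℂ 1)
      (q • (FreeAlgebra.ι ℂ 1 * FreeAlgebra.ι ℂ 0))

/-- Manin's quantum plane `ℂ_q[x, y] = ℂ⟨x, y | x y = q y x⟩`. -/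
abbrev QuantumPlane (q : ℂ) : Type := RingQuot (QuantumPlaneRel q)

namespace QuantumPlane

/-- The generator `x` of the quantum plane. -/
def x (q : ℂ) : QuantumPlane q := RingQuot.mkAlgHom ℂ (QuantumPlaneRel q) (FreeAlgebra.ι ℂ 0)

/-- The generator `y` of the quantum plane. -/
def y (q : ℂ) : QuantumPlane q := RingQuot.mkAlgHom ℂ (QuantumPlaneRel q) (FreeAlgebra.ι ℂ 1)

end QuantumPlane

end QuantumPlane

/-! ### Spaces of double sequences -/

section DoubleSeries

open scoped NNReal

variable {I : Type*} (w : I → ℕ × ℕ → ℝ≥0)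

/-- The space of double sequences `c` with `‖c‖ᵢ = ∑ |c_n| w i n < ∞` for all `i`. -/
def weightedSubmodule : Submodule ℂ (ℕ × ℕ → ℂ) where
  carrier := {c | ∀ i, Summable fun n => ‖c n‖ * w i n}
  zero_mem' i := by simp
  add_mem' {c d} hc hd i := by
    refine Summable.of_nonneg_of_le (fun n => by positivity) (fun n => ?_) ((hc i).add (hd i))
    rw [← add_mul]
    exact mul_le_mul_of_nonneg_right (norm_add_le _ _) (w i n).2
  smul_mem' a c hc i := by
    simpa [mul_assoc] using (hc i).mul_left ‖a‖

/-- The seminorm `‖c‖ᵢ = ∑ |c_n| w i n`. -/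
def weightedSeminorm (i : I) : Seminorm ℂ (weightedSubmodule w) :=
  Seminorm.of (fun c => ∑' n, ‖(c : ℕ × ℕ → ℂ) n‖ * w i n)
    (fun c d => by
      rw [← (c.2 i).tsum_add (d.2 i)]
      refine Summable.tsum_le_tsum (fun n => ?_) ((c + d).2 i) ((c.2 i).add (d.2 i))
      rw [← add_mul]
      exact mul_le_mul_of_nonneg_right (norm_add_le _ _) (w i n).2)
    (fun a c => by simp [mul_assoc, tsum_mul_left])

/-- The space of double sequences with `‖c‖ᵢ < ∞` for all `i`, with the topology given by the
seminorms `‖·‖ᵢ`. -/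
abbrev WeightedSpace : Type _ :=
  SemTop (weightedSubmodule w) (Set.range (weightedSeminorm w))

/-- The `n`-th coordinate of a double sequence. -/
def WeightedSpace.coord {w : I → ℕ × ℕ → ℝ≥0} (c : WeightedSpace w) (n : ℕ × ℕ) : ℂ :=
  (show weightedSubmodule w from c).1 n

/-- The weights of `‖c‖_{ρ,N} = ∑_{i ≤ N} ∑_j |c_{ij}| ρ^j`. -/
def formalEntireWeight : {ρ : ℝ≥0 // 0 < ρ} × ℕ → ℕ × ℕ → ℝ≥0 :=
  fun s n => if n.1 ≤ s.2 then s.1.1 ^ n.2 else 0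

/-- The weights of `‖c‖_ρ = ∑_{i,j} |c_{ij}| |q|^{ij} ρ^{i+j}`. -/
def quantumWeight (q : ℂ) : {ρ : ℝ≥0 // 0 < ρ} → ℕ × ℕ → ℝ≥0 :=
  fun ρ n => ‖q‖₊ ^ (n.1 * n.2) * ρ.1 ^ (n.1 + n.2)

end DoubleSeries

end AMSmash

end

open AMSmash
open scoped PowerSeries.WithPiTopology

noncomputable section

namespace AMSmash

open scoped TensorProduct Topology NNReal
open Filter UniformSpace

/-! ### Extension by continuity -/

section Extension

variable {D X Y : Type*} [AddCommGroup D] [Module ℂ D]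
  [AddCommGroup X] [Module ℂ X] [AddCommGroup Y] [Module ℂ Y]

/-! Write x and y for the generators `smashBasis q (1, 0)` and `smashBasis q (0, 1)`. The three
completions are computed in the same way. A family of seminorms given abstractly (stable,
submultiplicative or projective) is compared on monomials with an explicit family of weighted
ℓ¹-seminorms. If each family dominates the other on a dense subspace, the two completions coincide.
The comparison reduces to basis vectors by `le_basisSeminorm`, and
`exists_continuousLinearEquiv_extension` then gives the isomorphism.

For the H-completion, `delta 1` multiplies x^n by q^{-n}, so a stable seminorm p satisfies |q|^{-n}
p(x^n) ≤ C p(x^n). If |q| < 1, this forces p(x^n) = 0 for large n (`stable_le_truncWeight`).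
Conversely, the truncated norms are stable (`truncSeminorm_stable`). What remains is coefficientwise
convergence, that is, ℂ[[x]]. On the other factor, a submultiplicative seminorm of `delta j` grows
at most exponentially in j. The tensor product is therefore formal in x and entire in y
(`exists_analyticSmash_equiv`).

For the envelope, the relation x^i y^j = q^{ij} y^j x^i bounds every submultiplicative seminorm of
x^i y^j by a constant times |q|^{ij} ρ^{i+j} (`submul_le_quantumWeight`). The norms with these
weights are themselves submultiplicative when |q| < 1 (`basisSeminorm_quantumWeight_submul`).

The quantum weights dominate the formal-entire ones, so the canonical map Φ exists, and in
coordinates it does not change the coefficients. The series ∑ x^i is admissible in the formal space.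
In the envelope, however, the coefficients along y^0 must be summable, so this series has no
preimage (`not_surjective_of_extends`).

The bialgebra has no antipode because one would make y invertible, while evaluation at 0 is a
character that kills y. -/

/-- A linear map on a dense subspace that is bounded in every seminorm of a complete target
extends to a continuous linear map. -/
theorem exists_continuousLinearMap_extension
    [UniformSpace X] [IsUniformAddGroup X] [ContinuousConstSMul ℂ X]
    [UniformSpace Y] [IsUniformAddGroup Y] [ContinuousConstSMul ℂ Y] [CompleteSpace Y] [T2Space Y]
    (f : D →ₗ[ℂ] X) (hf : DenseRange f) (g : D →ₗ[ℂ] Y)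
    {ι : Type*} {Q : SeminormFamily ℂ Y ι} (hQ : WithSeminorms Q)
    (h : ∀ i, ∃ r : Seminorm ℂ X, Continuous r ∧ ∀ d, Q i (g d) ≤ r (f d)) :
    ∃ φ : X →L[ℂ] Y, ∀ d, φ (f d) = g d := by
  -- D receives the uniformity induced by f, which need not be injective. Then f is uniformly
  -- inducing with dense range, and the bounds `h` express the continuity of g.
  let _ : UniformSpace D := UniformSpace.comap f inferInstance
  have : IsUniformAddGroup D := IsUniformAddGroup.comap f
  have hfu : IsUniformInducing f := ⟨rfl⟩
  have hg : Continuous g := by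
    refine WithSeminorms.continuous_of_continuous_comp hQ g fun i => ?_
    obtain ⟨r, hr, hb⟩ := h i
    exact Seminorm.continuous_of_le (q := r.comp f)
      (hr.comp hfu.uniformContinuous.continuous) hb
  let f' : D →L[ℂ] X := ⟨f, hfu.uniformContinuous.continuous⟩
  let g' : D →L[ℂ] Y := ⟨g, hg⟩
  exact ⟨g'.extend f', fun d => ContinuousLinearMap.extend_eq g' (e := f') hf hfu d⟩

/-- The two composites agree with the identity on dense subsets of Hausdorff spaces, so they are the
identity. In this form a completion is identified by two seminorm estimates, one in each direction.
-/
theorem exists_continuousLinearEquiv_extension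
    [TopologicalSpace X] [T2Space X] [TopologicalSpace Y] [T2Space Y]
    (f : D →ₗ[ℂ] X) (hf : DenseRange f) (g : D →ₗ[ℂ] Y) (hg : DenseRange g)
    (h₁ : ∃ φ : X →L[ℂ] Y, ∀ d, φ (f d) = g d) (h₂ : ∃ ψ : Y →L[ℂ] X, ∀ d, ψ (g d) = f d) :
    ∃ e : X ≃L[ℂ] Y, ∀ d, e (f d) = g d := by
  obtain ⟨φ, hφ⟩ := h₁
  obtain ⟨ψ, hψ⟩ := h₂
  refine ⟨ContinuousLinearEquiv.equivOfInverse φ ψ (fun x => ?_) (fun y => ?_), hφ⟩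
  · exact congr_fun (hf.equalizer (ψ.continuous.comp φ.continuous) continuous_id
      (funext fun d => by simp [hφ, hψ])) x
  · exact congr_fun (hg.equalizer (φ.continuous.comp ψ.continuous) continuous_id
      (funext fun d => by simp [hφ, hψ])) y

end Extension

/-! ### Weighted `ℓ¹`-seminorms with respect to a basis -/

section BasisSeminorm

variable {ι E : Type*} [AddCommGroup E] [Module ℂ E] (b : Module.Basis ι ℂ E) (w : ι → ℝ≥0)

theorem summable_repr (u : E) : Summable fun n => ‖b.repr u n‖ * (w n : ℝ) := by
  refine summable_of_hasFiniteSupport ((b.repr u).support.finite_toSet.subset fun n hn => ?_)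
  simp only [Function.mem_support, ne_eq, mul_eq_zero, norm_eq_zero, not_or] at hn
  simpa using hn.1

/-- The seminorm `∑ |c_n| w_n` of `∑ c_n b_n`. -/
def basisSeminorm : Seminorm ℂ E :=
  Seminorm.of (fun u => ∑' n, ‖b.repr u n‖ * (w n : ℝ))
    (fun u v => by
      rw [← (summable_repr b w u).tsum_add (summable_repr b w v)]
      refine Summable.tsum_le_tsum (fun n => ?_) (summable_repr b w _)
        ((summable_repr b w u).add (summable_repr b w v))
      rw [← add_mul, map_add]
      exact mul_le_mul_of_nonneg_right (norm_add_le _ _) (w n).2)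
    (fun a u => by simp [mul_assoc, tsum_mul_left])

theorem basisSeminorm_apply (u : E) :
    basisSeminorm b w u = ∑' n, ‖b.repr u n‖ * (w n : ℝ) := rfl

theorem basisSeminorm_basis (n : ι) : basisSeminorm b w (b n) = w n := by
  classical
  rw [basisSeminorm_apply, tsum_eq_single n]
  · simp
  · intro m hm
    simp [hm.symm]

/-- A seminorm is determined up to domination by its values on a basis. -/
theorem le_basisSeminorm {p : Seminorm ℂ E} {C : ℝ} (h : ∀ n, p (b n) ≤ C * w n) (u : E) :
    p u ≤ C * basisSeminorm b w u := by
  have h1 : basisSeminorm b w u = ∑ n ∈ (b.repr u).support, ‖b.repr u n‖ * (w n : ℝ) :=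
    tsum_eq_sum fun n hn => by simp [Finsupp.notMem_support_iff.1 hn]
  have h2 : u = ∑ n ∈ (b.repr u).support, b.repr u n • b n := by
    conv_lhs => rw [← b.linearCombination_repr u, Finsupp.linearCombination_apply, Finsupp.sum]
  calc p u = p (∑ n ∈ (b.repr u).support, b.repr u n • b n) := by rw [← h2]
    _ ≤ ∑ n ∈ (b.repr u).support, p (b.repr u n • b n) :=
      Finset.le_sum_of_subadditive p (map_zero p).le (map_add_le_add p) _ _
    _ ≤ ∑ n ∈ (b.repr u).support, C * (‖b.repr u n‖ * (w n : ℝ)) := by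
      refine Finset.sum_le_sum fun n _ => ?_
      rw [map_smul_eq_mul]
      calc _ ≤ ‖b.repr u n‖ * (C * w n) := mul_le_mul_of_nonneg_left (h n) (norm_nonneg _)
        _ = _ := by ring
    _ = _ := by rw [h1, Finset.mul_sum]

theorem basisSeminorm_mono {w w' : ι → ℝ≥0} (h : ∀ n, w n ≤ w' n) (u : E) :
    basisSeminorm b w u ≤ basisSeminorm b w' u := by
  have := le_basisSeminorm b w' (p := basisSeminorm b w) (C := 1)
    (fun n => by rw [basisSeminorm_basis, one_mul]; exact_mod_cast h n) u
  rwa [one_mul] at this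

end BasisSeminorm

/-- A weighted `ℓ¹`-seminorm is submultiplicative if it is so on products of basis elements. -/
theorem basisSeminorm_mem_submulSeminorms {ι A : Type*} [Ring A] [Algebra ℂ A]
    (b : Module.Basis ι ℂ A) (w : ι → ℝ≥0)
    (h : ∀ m n, basisSeminorm b w (b m * b n) ≤ w m * w n) :
    basisSeminorm b w ∈ submulSeminorms A := by
  -- Domination on a basis is used once in each variable: first in the right factor with a basis
  -- vector fixed on the left, then in the left factor.
  have h1 : ∀ m v, basisSeminorm b w (b m * v) ≤ w m * basisSeminorm b w v := fun m v =>
    le_basisSeminorm b w (p := (basisSeminorm b w).comp (LinearMap.mulLeft ℂ (b m))) (h m) v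
  intro u v
  rw [mul_comm (basisSeminorm b w u)]
  refine le_basisSeminorm b w (p := (basisSeminorm b w).comp (LinearMap.mulRight ℂ v))
    (fun m => ?_) u
  rw [mul_comm]
  exact h1 m v

/-- The factor p 1 serves the exponent 0: submultiplicative seminorms are not normalised at the
unit. -/
theorem submul_pow_le {A : Type*} [Ring A] [Algebra ℂ A] {p : Seminorm ℂ A}
    (hp : p ∈ submulSeminorms A) (a : A) (n : ℕ) : p (a ^ n) ≤ p 1 * p a ^ n := by
  induction n with
  | zero => simp
  | succ n ih =>
    rw [pow_succ, pow_succ, ← mul_assoc]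
    exact (hp _ _).trans (mul_le_mul_of_nonneg_right ih (apply_nonneg _ _))

/-! ### Completeness of weighted spaces of double sequences -/

section Weighted

variable {I : Type*} {w : I → ℕ × ℕ → ℝ≥0}

namespace WeightedSpace

/-- The coordinates as linear functionals. -/
def coordLin (w : I → ℕ × ℕ → ℝ≥0) (n : ℕ × ℕ) : WeightedSpace w →ₗ[ℂ] ℂ :=
  (show weightedSubmodule w →ₗ[ℂ] ℂ from
    (LinearMap.proj n).comp (weightedSubmodule w).subtype)

theorem coordLin_apply (c : WeightedSpace w) (n : ℕ × ℕ) : coordLin w n c = c.coord n := rfl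

theorem summable_coord (c : WeightedSpace w) (i : I) : Summable fun n => ‖c.coord n‖ * (w i n : ℝ) :=
  (show weightedSubmodule w from c).2 i

/-- The defining seminorms on the weighted space. -/
def sem (w : I → ℕ × ℕ → ℝ≥0) (i : I) : Seminorm ℂ (WeightedSpace w) := weightedSeminorm w i

theorem sem_apply (c : WeightedSpace w) (i : I) :
    sem w i c = ∑' n, ‖c.coord n‖ * (w i n : ℝ) := rfl

theorem continuous_sem (i : I) : Continuous (sem w i) :=
  SemTop.continuous_of_mem (Set.range (weightedSeminorm w)) ⟨i, rfl⟩

/-- `SemTop` indexes its seminorms by the set of their values; this reindexes them by I, so that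
convergence can be tested weight by weight. -/
theorem withSeminorms_sem : WithSeminorms (sem w) := by
  rw [SeminormFamily.withSeminorms_iff_nhds_eq_iInf]
  have h := (SeminormFamily.withSeminorms_iff_nhds_eq_iInf _).1
    (SemTop.withSeminorms (Set.range (weightedSeminorm w)))
  exact h.trans (iInf_range' (fun s : Seminorm ℂ (weightedSubmodule w) =>
    comap s (𝓝 (0 : ℝ))) (weightedSeminorm w))

theorem norm_coord_mul_le (c : WeightedSpace w) (i : I) (n : ℕ × ℕ) :
    ‖c.coord n‖ * (w i n : ℝ) ≤ sem w i c :=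
  (summable_coord c i).le_tsum n fun _ _ => by positivity

/-- A weight that is positive at n bounds the n-th coordinate by a multiple of its seminorm. A
single weight need not do for all n: the formal-entire ones vanish beyond their truncation degree.
-/
theorem continuous_coordLin (hw : ∀ n, ∃ i, 0 < w i n) (n : ℕ × ℕ) :
    Continuous (coordLin w n) := by
  obtain ⟨i, hi⟩ := hw n
  refine WithSeminorms.continuous_of_continuous_comp (norm_withSeminorms ℂ ℂ) (coordLin w n)
    fun _ => ?_
  refine Seminorm.continuous_of_le (q := (w i n)⁻¹ • sem w i)
    ((continuous_sem i).const_smul _) fun c => ?_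
  change ‖c.coord n‖ ≤ ((w i n)⁻¹ : ℝ≥0) * sem w i c
  have hi' : (0 : ℝ) < w i n := hi
  rw [NNReal.coe_inv, ← div_eq_inv_mul, le_div_iff₀ hi']
  exact norm_coord_mul_le c i n

theorem ext_coord {c d : WeightedSpace w} (h : ∀ n, c.coord n = d.coord n) : c = d :=
  Subtype.ext (funext h)

theorem t2Space (hw : ∀ n, ∃ i, 0 < w i n) : T2Space (WeightedSpace w) := by
  refine T2Space.of_injective_continuous (f := fun c n => coordLin w n c)
    (fun c d h => ext_coord fun n => congr_fun h n)
    (continuous_pi fun n => continuous_coordLin hw n)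

/-- The usual ℓ¹ argument: a Cauchy filter converges coordinatewise to some z, and the Cauchy
estimates, read on finite partial sums, survive this limit. They show both that z lies in the space
and that the filter converges to z in every seminorm. -/
theorem completeSpace (hw : ∀ n, ∃ i, 0 < w i n) : CompleteSpace (WeightedSpace w) := by
  refine ⟨fun {F} hF => ?_⟩
  have := hF.1
  have hlim : ∀ n, ∃ z, Tendsto (coordLin w n) F (𝓝 z) := fun n =>
    CompleteSpace.complete (hF.map
      (uniformContinuous_addMonoidHom_of_continuous (f := (coordLin w n).toAddMonoidHom)
        (continuous_coordLin hw n)))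
  choose z hz using hlim
  -- Finite sums are continuous under coordinatewise limits, which the full series is not. Since the
  -- bound is uniform in s, it passes to the series afterwards.
  have hsmall : ∀ i (ε : ℝ), 0 < ε → ∃ S ∈ F, ∀ c ∈ S, ∀ s : Finset (ℕ × ℕ),
      ∑ n ∈ s, ‖c.coord n - z n‖ * (w i n : ℝ) ≤ ε := by
    intro i ε hε
    have hV : {x : WeightedSpace w × WeightedSpace w | sem w i (x.2 - x.1) < ε} ∈
        uniformity (WeightedSpace w) := by
      rw [uniformity_eq_comap_nhds_zero]
      refine ⟨{x | sem w i x < ε}, ?_, fun x hx => hx⟩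
      exact (isOpen_lt (continuous_sem i) continuous_const).mem_nhds (by simpa using hε)
    obtain ⟨S, hS, hSV⟩ := (cauchy_iff.1 hF).2 _ hV
    refine ⟨S, hS, fun c hc s => ?_⟩
    have ht : Tendsto (fun d : WeightedSpace w => ∑ n ∈ s, ‖c.coord n - coordLin w n d‖ *
        (w i n : ℝ)) F (𝓝 (∑ n ∈ s, ‖c.coord n - z n‖ * (w i n : ℝ))) :=
      tendsto_finsetSum _ fun n _ => ((tendsto_const_nhds.sub (hz n)).norm).mul_const _
    refine le_of_tendsto ht (Filter.mem_of_superset hS fun d hd => ?_)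
    have h1 : sem w i (c - d) < ε := hSV (show (d, c) ∈ S ×ˢ S from ⟨hd, hc⟩)
    exact ((summable_coord (c - d) i).sum_le_tsum s fun _ _ => by positivity).trans h1.le
  have hmem : z ∈ weightedSubmodule w := by
    intro i
    obtain ⟨S, hS, h⟩ := hsmall i 1 one_pos
    obtain ⟨c, hc⟩ := hF.1.nonempty_of_mem hS
    have h1 : Summable fun n => ‖c.coord n - z n‖ * (w i n : ℝ) :=
      summable_of_sum_le (fun n => by positivity) (h c hc)
    refine Summable.of_nonneg_of_le (fun n => by positivity) (fun n => ?_)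
      (h1.add (summable_coord c i))
    rw [← add_mul]
    refine mul_le_mul_of_nonneg_right ?_ (w i n).2
    calc ‖z n‖ = ‖c.coord n - (c.coord n - z n)‖ := by rw [sub_sub_cancel]
      _ ≤ ‖c.coord n‖ + ‖c.coord n - z n‖ := norm_sub_le _ _
      _ = _ := add_comm _ _
  let z' : WeightedSpace w := (⟨z, hmem⟩ : weightedSubmodule w)
  refine ⟨z', ?_⟩
  change Tendsto id F (𝓝 z')
  rw [withSeminorms_sem.tendsto_nhds]
  intro i ε hε
  obtain ⟨S, hS, h⟩ := hsmall i (ε / 2) (by positivity)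
  filter_upwards [hS] with c hc
  have h1 : sem w i (c - z') ≤ ε / 2 :=
    Real.tsum_le_of_sum_le (fun n => by positivity) (h c hc)
  exact h1.trans_lt (by linarith)

/-- The monomial with exponent `n`. -/
def single (w : I → ℕ × ℕ → ℝ≥0) (n : ℕ × ℕ) : WeightedSpace w :=
  (⟨Pi.single n 1, fun i => summable_of_hasFiniteSupport ((Set.finite_singleton n).subset
    fun m hm => by
      by_contra hne
      simp [Pi.single_apply, show m ≠ n from hne] at hm)⟩ : weightedSubmodule w)

theorem coord_single (n : ℕ × ℕ) : (single w n).coord = Pi.single n 1 := rfl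

theorem coord_sum_smul_single (c : ℕ × ℕ → ℂ) (s : Finset (ℕ × ℕ)) (m : ℕ × ℕ) :
    (∑ n ∈ s, c n • single w n).coord m = if m ∈ s then c m else 0 := by
  rw [← coordLin_apply, map_sum]
  simp [coordLin_apply, coord_single, Pi.single_apply]

/-- Subtracting the partial sum over s leaves, in each seminorm, the tail of a convergent series
over the complement of s. This yields the density of finite combinations of monomials. -/
theorem hasSum_single (c : WeightedSpace w) : HasSum (fun n => c.coord n • single w n) c := by
  change Tendsto _ _ _
  rw [withSeminorms_sem.tendsto_nhds]
  intro i ε hε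
  have h := (tendsto_order.1 (tendsto_tsum_compl_atTop_zero
    fun n => ‖c.coord n‖ * (w i n : ℝ))).2 ε hε
  filter_upwards [h] with s hs
  rw [sem_apply]
  refine lt_of_eq_of_lt ?_ hs
  have h0 : ∀ n, (∑ n ∈ s, c.coord n • single w n - c).coord n =
      if n ∈ s then 0 else - c.coord n := fun n => by
    rw [← coordLin_apply, map_sub, coordLin_apply, coordLin_apply, coord_sum_smul_single]
    split_ifs <;> simp
  simp only [h0]
  refine Eq.trans (tsum_congr fun n => ?_)
    (tsum_subtype {n | n ∉ s} fun n => ‖c.coord n‖ * (w i n : ℝ)).symm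
  by_cases hn : n ∈ s <;> simp [hn, Set.indicator]

/-- The linear map that sends the elements of a basis to the monomials. -/
def ofBasis {E : Type*} [AddCommGroup E] [Module ℂ E] (b : Module.Basis (ℕ × ℕ) ℂ E)
    (w : I → ℕ × ℕ → ℝ≥0) : E →ₗ[ℂ] WeightedSpace w :=
  (show E →ₗ[ℂ] weightedSubmodule w from
    { toFun := fun u => ⟨b.repr u, fun i => summable_repr b (w i) u⟩
      map_add' := fun u v => Subtype.ext (by ext; simp)
      map_smul' := fun a u => Subtype.ext (by ext; simp) })

variable {E : Type*} [AddCommGroup E] [Module ℂ E] (b : Module.Basis (ℕ × ℕ) ℂ E)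

theorem coord_ofBasis (u : E) (n : ℕ × ℕ) : (ofBasis b w u).coord n = b.repr u n := rfl

theorem sem_ofBasis (u : E) (i : I) : sem w i (ofBasis b w u) = basisSeminorm b (w i) u := rfl

theorem ofBasis_basis (n : ℕ × ℕ) : ofBasis b w (b n) = single w n := by
  refine ext_coord fun m => ?_
  rw [coord_ofBasis, coord_single, b.repr_self, Finsupp.single_eq_pi_single]

theorem denseRange_ofBasis : DenseRange (ofBasis b w) := by
  intro c
  refine mem_closure_of_tendsto (hasSum_single c) (Eventually.of_forall fun s => ?_)
  refine ⟨∑ n ∈ s, c.coord n • b n, ?_⟩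
  simp [ofBasis_basis]

end WeightedSpace

end Weighted

/-! ### The smash product `ℂ[x] # ℂℤ₊` and the quantum plane -/

section SmashBasis

/-- The evaluation `ℂℤ₊ = ℂ[t] → ℂ` at `t = 0`. -/
def evalZero : AddMonoidAlgebra ℂ ℕ →ₐ[ℂ] ℂ :=
  AddMonoidAlgebra.lift ℂ ℂ ℕ (powersHom ℂ 0)

theorem evalZero_delta_one : evalZero (delta 1) = 0 := by
  simp [evalZero, delta, AddMonoidAlgebra.lift_single]

theorem comul_delta (k : ℕ) : Coalgebra.comul (R := ℂ) (delta k) = delta k ⊗ₜ[ℂ] delta k := by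
  simp [delta]

theorem counit_delta (k : ℕ) : Coalgebra.counit (R := ℂ) (delta k) = 1 := by
  simp [delta]

theorem delta_zero : delta 0 = 1 := rfl

theorem delta_mul (j k : ℕ) : delta j * delta k = delta (j + k) := by
  simp [delta, AddMonoidAlgebra.single_mul_single]

theorem delta_one_pow (j : ℕ) : delta 1 ^ j = delta j := by
  induction j with
  | zero => rfl
  | succ j ih => rw [pow_succ, ih, delta_mul]

/-- As `delta 1` is grouplike, an antipode S would satisfy S(δ₁) δ₁ = 1. Applying the character
`evalZero`, which kills δ₁, gives 0 = 1. -/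
theorem not_exists_hopfAlgebra : ¬ ∃ S : HopfAlgebra ℂ (AddMonoidAlgebra ℂ ℕ),
    S.toHopfAlgebraStruct.toBialgebra = AddMonoidAlgebra.instBialgebra ℂ ℂ ℕ := by
  -- The structure is taken apart so that its bialgebra part becomes a variable, which `subst`
  -- replaces by the given one.
  rintro ⟨@⟨@⟨_, s⟩, h₁, h₂⟩, hS⟩
  subst hS
  have h := congrArg evalZero (LinearMap.congr_fun h₁ (delta 1))
  simp only [LinearMap.comp_apply, comul_delta, counit_delta, LinearMap.rTensor_tmul,
    LinearMap.mul'_apply, map_mul, evalZero_delta_one, mul_zero, map_one,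
    Algebra.linearMap_apply] at h
  exact zero_ne_one h

variable (q : ℂ)

theorem qAction_act_delta (k : ℕ) (f : Polynomial ℂ) : (qAction q).act (delta k) f =
    f.comp (Polynomial.C (q ^ k)⁻¹ * Polynomial.X) := by
  rw [Polynomial.comp_eq_aeval]
  simp [qAction, ModuleAlgebra.ofEndomorphisms, delta, AddMonoidAlgebra.lift_single]

theorem qAction_act_delta_X_pow (k n : ℕ) : (qAction q).act (delta k) (Polynomial.X ^ n) =
    (q ^ (k * n))⁻¹ • (Polynomial.X ^ n : Polynomial ℂ) := by
  rw [qAction_act_delta, Polynomial.X_pow_comp, mul_pow, ← Polynomial.C_pow,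
    ← Polynomial.smul_eq_C_mul, inv_pow, pow_mul]

/-- The comultiplication of a grouplike element has a single term, so the sum in the smash product
collapses. -/
theorem smashTmul_delta_mul (a b : Polynomial ℂ) (j l : ℕ) :
    (qAction q).smashTmul a (delta j) * (qAction q).smashTmul b (delta l) =
      (qAction q).smashTmul (a * (qAction q).act (delta j) b) (delta (j + l)) := by
  refine ((qAction q).smashMul_tmul a b (delta j) (delta l)).trans ?_
  rw [comul_delta, TensorProduct.map_tmul, LinearMap.mulRight_apply, delta_mul]
  rfl

/-- The basis `x^i ⊗ δ_j` of `ℂ[x] # ℂℤ₊`. -/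
def smashBasis : Module.Basis (ℕ × ℕ) ℂ (qAction q).Smash :=
  (show Module.Basis (ℕ × ℕ) ℂ (Polynomial ℂ ⊗[ℂ] AddMonoidAlgebra ℂ ℕ) from
    (Polynomial.basisMonomials ℂ).tensorProduct (AddMonoidAlgebra.basis ℕ ℂ))

theorem smashBasis_apply (n : ℕ × ℕ) :
    smashBasis q n = (qAction q).smashTmul (Polynomial.X ^ n.1) (delta n.2) := by
  refine (Module.Basis.tensorProduct_apply _ _ n.1 n.2).trans ?_
  rw [Polynomial.coe_basisMonomials, AddMonoidAlgebra.basis_apply]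
  exact congrArg (· ⊗ₜ[ℂ] delta n.2) (Polynomial.X_pow_eq_monomial n.1).symm

theorem smashTmul_smul (a : Polynomial ℂ) (c : ℂ) (h : AddMonoidAlgebra ℂ ℕ) :
    (qAction q).smashTmul (c • a) h = c • (qAction q).smashTmul a h :=
  (TensorProduct.smul_tmul' c a h).symm

/-- The scalar is the cost of moving y^{m.2} to the right past x^{n.1}. The later computations in
the smash product rest on these structure constants. -/
theorem smashBasis_mul (m n : ℕ × ℕ) :
    smashBasis q m * smashBasis q n = (q ^ (m.2 * n.1))⁻¹ • smashBasis q (m + n) := by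
  rw [smashBasis_apply, smashBasis_apply, smashBasis_apply, smashTmul_delta_mul,
    qAction_act_delta_X_pow, mul_smul_comm, ← pow_add, smashTmul_smul]
  rfl

theorem smashBasis_zero : smashBasis q 0 = 1 := by
  rw [smashBasis_apply]
  rfl

theorem smashBasis_pow_fst (i : ℕ) : smashBasis q (1, 0) ^ i = smashBasis q (i, 0) := by
  induction i with
  | zero => rw [pow_zero, ← smashBasis_zero]; rfl
  | succ i ih => rw [pow_succ, ih, smashBasis_mul]; simp

theorem smashBasis_pow_snd (j : ℕ) : smashBasis q (0, 1) ^ j = smashBasis q (0, j) := by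
  induction j with
  | zero => rw [pow_zero, ← smashBasis_zero]; rfl
  | succ i ih => rw [pow_succ, ih, smashBasis_mul]; simp

theorem smashBasis_pow_mul_pow (i j : ℕ) :
    smashBasis q (1, 0) ^ i * smashBasis q (0, 1) ^ j = smashBasis q (i, j) := by
  rw [smashBasis_pow_fst, smashBasis_pow_snd, smashBasis_mul]; simp

/-- Writing the monomial in the opposite order exposes the factor q^{ij}, which is the source of
|q|^{ij} in the norms of the envelope. -/
theorem smashBasis_eq_smul (hq : q ≠ 0) (i j : ℕ) : smashBasis q (i, j) =
    q ^ (i * j) • (smashBasis q (0, 1) ^ j * smashBasis q (1, 0) ^ i) := by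
  rw [smashBasis_pow_fst, smashBasis_pow_snd, smashBasis_mul, smul_smul, mul_comm j i,
    mul_inv_cancel₀ (pow_ne_zero _ hq), one_smul]
  simp

end SmashBasis

/-! ### Normal ordering in the quantum plane and its isomorphism with the smash product -/

namespace QuantumPlane

variable (q : ℂ)

theorem x_mul_y : x q * y q = q • (y q * x q) := by
  have := RingQuot.mkAlgHom_rel ℂ (QuantumPlaneRel.rel (q := q))
  rw [map_mul, map_smul, map_mul] at this
  exact this

theorem y_mul_x_pow (hq : q ≠ 0) (k : ℕ) : y q * x q ^ k = (q ^ k)⁻¹ • (x q ^ k * y q) := by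
  have h : y q * x q = q⁻¹ • (x q * y q) := by
    rw [x_mul_y, smul_smul, inv_mul_cancel₀ hq, one_smul]
  induction k with
  | zero => simp
  | succ k ih =>
    rw [pow_succ, ← mul_assoc, ih, smul_mul_assoc, mul_assoc, h, mul_smul_comm, smul_smul,
      ← mul_assoc, pow_succ, mul_inv]

theorem y_pow_mul_x_pow (hq : q ≠ 0) (j k : ℕ) :
    y q ^ j * x q ^ k = (q ^ (j * k))⁻¹ • (x q ^ k * y q ^ j) := by
  induction j with
  | zero => simp
  | succ j ih =>
    rw [pow_succ', mul_assoc, ih, mul_smul_comm, ← mul_assoc, y_mul_x_pow q hq, smul_mul_assoc,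
      smul_smul, mul_assoc, ← mul_inv, ← pow_add, add_mul, one_mul]

/-- The homomorphism `ℂ_q[x, y] → ℂ[x] # ℂℤ₊`. -/
def toSmash (hq : q ≠ 0) : QuantumPlane q →ₐ[ℂ] (qAction q).Smash :=
  RingQuot.liftAlgHom ℂ ⟨FreeAlgebra.lift ℂ ![smashBasis q (1, 0), smashBasis q (0, 1)], by
    rintro _ _ ⟨⟩
    simp only [map_mul, map_smul, FreeAlgebra.lift_ι_apply, Matrix.cons_val_zero,
      Matrix.cons_val_one, smashBasis_mul, smul_smul]
    simp [hq]⟩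

theorem toSmash_x (hq : q ≠ 0) : toSmash q hq (x q) = smashBasis q (1, 0) := by
  simp [toSmash, x]

theorem toSmash_y (hq : q ≠ 0) : toSmash q hq (y q) = smashBasis q (0, 1) := by
  simp [toSmash, y]

/-- The homomorphism `ℂ[x] # ℂℤ₊ → ℂ_q[x, y]`. -/
def ofSmash (hq : q ≠ 0) : (qAction q).Smash →ₐ[ℂ] QuantumPlane q :=
  AlgHom.ofLinearMap ((smashBasis q).constr ℂ fun n => x q ^ n.1 * y q ^ n.2)
    (by rw [← smashBasis_zero, Module.Basis.constr_basis]; simp)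
    (by
      -- Multiplicativity is an equality of bilinear maps, so it suffices to check pairs of basis
      -- elements. There, normal ordering in the quantum plane produces the same scalar as
      -- `smashBasis_mul`.
      rw [LinearMap.map_mul_iff]
      refine (smashBasis q).ext fun m => (smashBasis q).ext fun n => ?_
      simp only [LinearMap.compr₂_apply, LinearMap.mul_apply', LinearMap.compl₂_apply, LinearMap.comp_apply,
        smashBasis_mul, map_smul, Module.Basis.constr_basis, Prod.fst_add, Prod.snd_add]
      rw [mul_assoc, ← mul_assoc (y q ^ m.2), y_pow_mul_x_pow q hq, smul_mul_assoc, mul_smul_comm,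
        pow_add, pow_add]
      simp only [mul_assoc])

theorem ofSmash_smashBasis (hq : q ≠ 0) (n : ℕ × ℕ) :
    ofSmash q hq (smashBasis q n) = x q ^ n.1 * y q ^ n.2 :=
  Module.Basis.constr_basis (smashBasis q) ℂ _ n

/-- The isomorphism `ℂ_q[x, y] ≅ ℂ[x] # ℂℤ₊`. -/
def equivSmash (hq : q ≠ 0) : QuantumPlane q ≃ₐ[ℂ] (qAction q).Smash :=
  AlgEquiv.ofAlgHom (toSmash q hq) (ofSmash q hq)
    -- One composite is tested on the monomial basis, the other on the two generators. Thus no basis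
    -- of the quantum plane has to be known beforehand.
    (AlgHom.toLinearMap_injective ((smashBasis q).ext fun n => by
      simp [ofSmash_smashBasis, toSmash_x, toSmash_y, smashBasis_pow_mul_pow]))
    (by
      refine RingQuot.ringQuot_ext' _ _ _ (FreeAlgebra.hom_ext (funext fun i => ?_))
      fin_cases i
      · exact (congrArg _ (toSmash_x q hq)).trans
          ((ofSmash_smashBasis q hq _).trans (by simp; rfl))
      · exact (congrArg _ (toSmash_y q hq)).trans
          ((ofSmash_smashBasis q hq _).trans (by simp; rfl)))

theorem equivSmash_pow_mul_pow (hq : q ≠ 0) (i j : ℕ) :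
    equivSmash q hq (x q ^ i * y q ^ j) = smashBasis q (i, j) := by
  rw [map_mul, map_pow, map_pow, ← smashBasis_pow_mul_pow]
  exact congrArg₂ _ (congrArg (· ^ i) (toSmash_x q hq)) (congrArg (· ^ j) (toSmash_y q hq))

end QuantumPlane

/-! ### Seminorms on completions -/

section CompletionSeminorms

variable {E : Type*} [AddCommGroup E] [Module ℂ E] {S : Set (Seminorm ℂ E)}

/-- This and the next lemma carry estimates between a space and its completion: defining seminorms
extend continuously, and for a saturated family every continuous seminorm is dominated on the dense
image by a single defining one. -/
theorem exists_continuous_seminorm_completion {p : Seminorm ℂ E} (hp : p ∈ S) :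
    ∃ r : Seminorm ℂ (Completion (SemTop E S)), Continuous r ∧
      ∀ u : SemTop E S, r (toCompl (SemTop E S) u) = p u := by
  have h := SemTop.continuous_of_mem S hp
  exact ⟨completionSeminorm (show Seminorm ℂ (SemTop E S) from p) h,
    continuous_completionSeminorm _ h, fun u => completionSeminorm_coe _ h u⟩

theorem SemTop.Saturated.exists_le_completion (hS : SemTop.Saturated S)
    {r : Seminorm ℂ (Completion (SemTop E S))} (hr : Continuous r) :
    ∃ p ∈ S, ∀ u : SemTop E S, r (toCompl (SemTop E S) u) ≤ p u :=
  hS.exists_le (r.comp (toCompl (SemTop E S)).toLinearMap)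
    (hr.comp (toCompl (SemTop E S)).continuous)

end CompletionSeminorms

/-- A continuous linear map that extends a homomorphism on a dense subalgebra is
multiplicative. -/
theorem map_mul_of_denseRange {B X Y : Type*} [Mul B]
    [Ring X] [Algebra ℂ X] [TopologicalSpace X] [ContinuousMul X]
    [Ring Y] [Algebra ℂ Y] [TopologicalSpace Y] [ContinuousMul Y] [T2Space Y]
    {f : B → X} (hf : DenseRange f) (hfm : ∀ a b, f (a * b) = f a * f b)
    {g : B → Y} (hgm : ∀ a b, g (a * b) = g a * g b)
    (φ : X →L[ℂ] Y) (h : ∀ a, φ (f a) = g a) (x y : X) : φ (x * y) = φ x * φ y := by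
  refine hf.induction_on₂ (p := fun x y => φ (x * y) = φ x * φ y) ?_ ?_ x y
  · exact isClosed_eq (by fun_prop) (by fun_prop)
  · intro a b
    rw [← hfm, h, h, h, hgm]

theorem denseRange_toAMEnvelope (B : Type*) [Ring B] [Algebra ℂ B] :
    DenseRange (toAMEnvelope B) :=
  denseRange_toCompl (E := AMTop B)

/-! ### Positivity and completeness of the weighted spaces -/

theorem WeightedSpace.completeLCS {I : Type*} {w : I → ℕ × ℕ → ℝ≥0} (hw : ∀ n, ∃ i, 0 < w i n) :
    CompleteLCS (WeightedSpace w) where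
  __ := (inferInstance : LCS (WeightedSpace w))
  __ := WeightedSpace.completeSpace hw
  __ := WeightedSpace.t2Space hw

theorem formalEntireWeight_pos (n : ℕ × ℕ) : ∃ i, 0 < formalEntireWeight i n :=
  ⟨(⟨1, one_pos⟩, n.1), by simp [formalEntireWeight]⟩

instance : CompleteLCS (WeightedSpace formalEntireWeight) :=
  WeightedSpace.completeLCS formalEntireWeight_pos

theorem quantumWeight_pos {q : ℂ} (hq : q ≠ 0) (n : ℕ × ℕ) : ∃ i, 0 < quantumWeight q i n :=
  ⟨⟨1, one_pos⟩, by
    have : 0 < ‖q‖₊ := nnnorm_pos.2 hq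
    simp only [quantumWeight]
    positivity⟩

theorem formalEntireWeight_mono {ρ ρ' : {ρ : ℝ≥0 // 0 < ρ}} {N N' : ℕ} (hρ : ρ.1 ≤ ρ'.1)
    (hN : N ≤ N') (n : ℕ × ℕ) : formalEntireWeight (ρ, N) n ≤ formalEntireWeight (ρ', N') n := by
  simp only [formalEntireWeight]
  split_ifs with h h'
  · gcongr
  · exact absurd (h.trans hN) h'
  · exact zero_le
  · exact le_rfl

theorem WeightedSpace.sem_mono {I : Type*} {w : I → ℕ × ℕ → ℝ≥0} {i j : I}
    (h : ∀ n, w i n ≤ w j n) (c : WeightedSpace w) : sem w i c ≤ sem w j c :=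
  Summable.tsum_le_tsum (fun n => mul_le_mul_of_nonneg_left (h n) (norm_nonneg _))
    (summable_coord c i) (summable_coord c j)

/-- The seminorms `‖·‖_{ρ,N}` dominate all continuous seminorms. -/
theorem exists_le_sem_formalEntireWeight (r : Seminorm ℂ (WeightedSpace formalEntireWeight))
    (hr : Continuous r) : ∃ (i : {ρ : ℝ≥0 // 0 < ρ} × ℕ) (C : ℝ≥0),
      ∀ c, r c ≤ C * WeightedSpace.sem formalEntireWeight i c := by
  classical
  obtain ⟨s, C, -, h⟩ := Seminorm.bound_of_continuous WeightedSpace.withSeminorms_sem r hr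
  -- The weights increase with ρ and N, so the family is directed: a finite supremum is bounded by
  -- the seminorm with the largest ρ and the largest N.
  have hs : ∀ s : Finset ({ρ : ℝ≥0 // 0 < ρ} × ℕ), ∃ i,
      s.sup (WeightedSpace.sem formalEntireWeight) ≤ WeightedSpace.sem formalEntireWeight i := by
    intro s
    induction s using Finset.induction_on with
    | empty => exact ⟨(⟨1, one_pos⟩, 0), bot_le⟩
    | insert a s _ ih =>
      obtain ⟨i, hi⟩ := ih
      refine ⟨(⟨max a.1.1 i.1.1, lt_max_of_lt_left a.1.2⟩, max a.2 i.2), ?_⟩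
      rw [Finset.sup_insert]
      refine sup_le ?_ (hi.trans ?_)
      · exact fun c => WeightedSpace.sem_mono
          (formalEntireWeight_mono (le_max_left _ _) (le_max_left _ _)) c
      · exact fun c => WeightedSpace.sem_mono
          (formalEntireWeight_mono (le_max_right _ _) (le_max_right _ _)) c
  obtain ⟨i, hi⟩ := hs s
  exact ⟨i, C, fun c => (h c).trans (mul_le_mul_of_nonneg_left (hi c) C.2)⟩

/-! ### Stable seminorms on `ℂ[x]` and submultiplicative seminorms on `ℂℤ₊` -/

section Stable

/-- The weights of `∑_{n ≤ N} |c_n|`. -/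
def truncWeight (N n : ℕ) : ℝ≥0 := if n ≤ N then 1 else 0

/-- The seminorm `∑_{n ≤ N} |c_n|` on `ℂ[x]`. -/
def truncSeminorm (N : ℕ) : Seminorm ℂ (Polynomial ℂ) :=
  basisSeminorm (Polynomial.basisMonomials ℂ) (truncWeight N)

theorem basisMonomials_eq_X_pow (n : ℕ) :
    Polynomial.basisMonomials ℂ n = (Polynomial.X ^ n : Polynomial ℂ) := by
  rw [Polynomial.coe_basisMonomials, Polynomial.X_pow_eq_monomial]

theorem truncSeminorm_X_pow (N n : ℕ) : truncSeminorm N (Polynomial.X ^ n) = truncWeight N n := by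
  rw [← basisMonomials_eq_X_pow, truncSeminorm, basisSeminorm_basis]

/-- If m + n ≤ N then m ≤ N and n ≤ N, so the weight of a product is at most the product of the
weights. -/
theorem truncSeminorm_submul (N : ℕ) : truncSeminorm N ∈ submulSeminorms (Polynomial ℂ) := by
  refine basisSeminorm_mem_submulSeminorms _ _ fun m n => ?_
  rw [basisMonomials_eq_X_pow, basisMonomials_eq_X_pow, ← pow_add]
  refine (truncSeminorm_X_pow N (m + n)).le.trans ?_
  simp only [truncWeight]
  norm_cast
  split_ifs <;> omega

theorem norm_coeff_le_truncSeminorm (n : ℕ) (f : Polynomial ℂ) :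
    ‖f.coeff n‖ ≤ truncSeminorm n f := by
  have h : ‖f.coeff n‖ * (truncWeight n n : ℝ) ≤ truncSeminorm n f :=
    (summable_repr (Polynomial.basisMonomials ℂ) (truncWeight n) f).le_tsum n
      fun _ _ => by positivity
  simpa [truncWeight] using h

variable {q : ℂ}

/-- The element δ_k scales x^n by q^{-kn}. These factors are unbounded in n, but the truncation
retains only n ≤ N, where |q|^{-kN} bounds them. -/
theorem truncSeminorm_stable (hq : q ≠ 0) (hq1 : ‖q‖ < 1) (N : ℕ) :
    truncSeminorm N ∈ (qAction q).stableSeminorms := by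
  refine ⟨truncSeminorm_submul N, fun h => ?_⟩
  induction h using AddMonoidAlgebra.induction_linear with
  | zero => exact ⟨1, one_pos, fun a => by simp⟩
  | add f g hf hg =>
    obtain ⟨C, hC, h1⟩ := hf
    obtain ⟨D, hD, h2⟩ := hg
    refine ⟨C + D, by positivity, fun a => ?_⟩
    rw [map_add, LinearMap.add_apply, add_mul]
    exact (map_add_le_add _ _ _).trans (add_le_add (h1 a) (h2 a))
  | single k c =>
    have hc : AddMonoidAlgebra.single k c = c • delta k := by simp [delta]
    -- The summand 1 keeps the constant positive when c = 0.
    refine ⟨‖c‖ * (‖q‖ ^ (k * N))⁻¹ + 1, by positivity, ?_⟩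
    refine le_basisSeminorm _ _
      (p := (truncSeminorm N).comp ((qAction q).act (AddMonoidAlgebra.single k c))) fun n => ?_
    rw [Seminorm.comp_apply, hc, map_smul, LinearMap.smul_apply, basisMonomials_eq_X_pow,
      qAction_act_delta_X_pow, map_smul_eq_mul, map_smul_eq_mul, truncSeminorm_X_pow, norm_inv,
      norm_pow, ← mul_assoc]
    by_cases hn : n ≤ N
    · have hq0 : 0 < ‖q‖ := norm_pos_iff.2 hq
      have h1 : (‖q‖ ^ (k * n))⁻¹ ≤ (‖q‖ ^ (k * N))⁻¹ :=
        inv_anti₀ (by positivity) (pow_le_pow_of_le_one hq0.le hq1.le (by gcongr))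
      have h2 := mul_le_mul_of_nonneg_left h1 (norm_nonneg c)
      simp only [truncWeight, hn, if_true, NNReal.coe_one, mul_one]
      linarith
    · simp [truncWeight, hn]

/-- A stable seminorm vanishes on high powers of `x`. -/
theorem stable_le_truncWeight (hq : q ≠ 0) (hq1 : ‖q‖ < 1) {p : Seminorm ℂ (Polynomial ℂ)}
    (hp : p ∈ (qAction q).stableSeminorms) :
    ∃ (N : ℕ) (C : ℝ), 0 ≤ C ∧ ∀ n, p (Polynomial.X ^ n) ≤ C * truncWeight N n := by
  obtain ⟨C, -, hC⟩ := hp.2 (delta 1)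
  have hq0 : 0 < ‖q‖ := norm_pos_iff.2 hq
  have hq2 : 1 < ‖q‖⁻¹ := (one_lt_inv₀ hq0).2 hq1
  -- Stability under δ₁ gives |q|^{-n} p(x^n) ≤ C p(x^n). For n > N the factor on the left exceeds
  -- C, hence p(x^n) = 0. For n ≤ N, the sum chosen as the constant contains p(x^n) as a term.
  obtain ⟨N, hN⟩ := pow_unbounded_of_one_lt C hq2
  refine ⟨N, ∑ n ∈ Finset.range (N + 1), p (Polynomial.X ^ n),
    Finset.sum_nonneg fun _ _ => apply_nonneg _ _, fun n => ?_⟩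
  by_cases hn : n ≤ N
  · simp only [truncWeight, hn, if_true, NNReal.coe_one, mul_one]
    exact Finset.single_le_sum (f := fun n => p (Polynomial.X ^ n))
      (fun _ _ => apply_nonneg _ _) (Finset.mem_range.2 (by omega))
  · simp only [truncWeight, hn, if_false, NNReal.coe_zero, mul_zero]
    have h1 := hC (Polynomial.X ^ n)
    rw [qAction_act_delta_X_pow, map_smul_eq_mul, norm_inv, norm_pow, one_mul, ← inv_pow] at h1
    have h2 : C < ‖q‖⁻¹ ^ n := hN.trans_le (pow_le_pow_right₀ hq2.le (by omega))
    by_contra h3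
    exact absurd (le_of_mul_le_mul_right h1 (not_le.1 h3)) (not_le.2 h2)

theorem stable_le_truncSeminorm (hq : q ≠ 0) (hq1 : ‖q‖ < 1) {p : Seminorm ℂ (Polynomial ℂ)}
    (hp : p ∈ (qAction q).stableSeminorms) :
    ∃ (N : ℕ) (C : ℝ), 0 ≤ C ∧ ∀ f, p f ≤ C * truncSeminorm N f := by
  obtain ⟨N, C, hC, h⟩ := stable_le_truncWeight hq hq1 hp
  exact ⟨N, C, hC, le_basisSeminorm _ _ fun n => by rw [basisMonomials_eq_X_pow]; exact h n⟩

/-- The seminorm `∑ |c_j| ρ^j` on `ℂℤ₊`. -/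
def expSeminorm (ρ : ℝ≥0) : Seminorm ℂ (AddMonoidAlgebra ℂ ℕ) :=
  basisSeminorm (AddMonoidAlgebra.basis ℕ ℂ) fun j => ρ ^ j

theorem expSeminorm_submul (ρ : ℝ≥0) : expSeminorm ρ ∈ submulSeminorms (AddMonoidAlgebra ℂ ℕ) := by
  refine basisSeminorm_mem_submulSeminorms _ _ fun m n => ?_
  have h : AddMonoidAlgebra.basis ℕ ℂ m * AddMonoidAlgebra.basis ℕ ℂ n =
      AddMonoidAlgebra.basis ℕ ℂ (m + n) := delta_mul m n
  rw [h, basisSeminorm_basis]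
  push_cast
  rw [pow_add]

end Stable

/-! ### The completion of `ℂ[x]` -/

section PowerSeries

open scoped PowerSeries.WithPiTopology

variable {q : ℂ}

theorem denseRange_toHCompletion : DenseRange (qAction q).toHCompletion :=
  denseRange_toCompl (E := (qAction q).StableTop)

/-- The coefficient seminorms define the topology of `ℂ[[x]]`. -/
theorem powerSeries_withSeminorms :
    WithSeminorms (fun n : ℕ => (normSeminorm ℂ ℂ).comp (PowerSeries.coeff (R := ℂ) n)) := by
  rw [SeminormFamily.withSeminorms_iff_nhds_eq_iInf]
  refine le_antisymm (le_iInf fun n => ?_) ?_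
  · rw [← map_le_iff_le_comap]
    refine Continuous.tendsto' ?_ _ _ (map_zero _)
    exact continuous_norm.comp (PowerSeries.WithPiTopology.continuous_coeff ℂ n)
  · refine (PowerSeries.WithPiTopology.tendsto_iff_coeff_tendsto ℂ id _ 0).2 fun n => ?_
    rw [map_zero, tendsto_zero_iff_norm_tendsto_zero]
    exact tendsto_iff_comap.2 (iInf_le _ n)

theorem truncSeminorm_eq_sum (N : ℕ) (f : Polynomial ℂ) :
    truncSeminorm N f = ∑ n ∈ Finset.range (N + 1), ‖f.coeff n‖ := by
  have h : truncSeminorm N f = ∑' n, ‖f.coeff n‖ * (truncWeight N n : ℝ) := rfl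
  rw [h, tsum_eq_sum (s := Finset.range (N + 1))]
  · refine Finset.sum_congr rfl fun n hn => ?_
    simp [truncWeight, Nat.lt_succ_iff.1 (Finset.mem_range.1 hn)]
  · intro n hn
    have : ¬ n ≤ N := by simpa using hn
    simp [truncWeight, this]

/-- The inclusion `ℂ[x] → ℂ[[x]]` as a linear map. -/
def polyToPowerSeries : Polynomial ℂ →ₗ[ℂ] PowerSeries ℂ where
  toFun f := f
  map_add' f g := Polynomial.coe_add f g
  map_smul' c f := Polynomial.coe_smul f c

/-- Coefficient seminorms are bounded by stable ones, and stable ones by finite sums of coefficient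
seminorms. Polynomials are dense on both sides, and multiplicativity passes to the limit. -/
theorem exists_hCompletion_equiv (hq : q ≠ 0) (hq1 : ‖q‖ < 1) :
    ∃ e : (qAction q).HCompletion ≃A[ℂ] PowerSeries ℂ,
      ∀ f : Polynomial ℂ, e ((qAction q).toHCompletion f) = (f : PowerSeries ℂ) := by
  have : ContinuousConstSMul ℂ (PowerSeries ℂ) := ⟨fun c => by
    refine (continuous_const_mul (PowerSeries.C c)).congr fun f => ?_
    rw [PowerSeries.smul_eq_C_mul]⟩
  have hS : SemTop.Saturated (qAction q).stableSeminorms := SubmulFamily.saturated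
  have hd : DenseRange polyToPowerSeries := PowerSeries.WithPiTopology.denseRange_toPowerSeries ℂ
  obtain ⟨e, he⟩ := exists_continuousLinearEquiv_extension
    (qAction q).toHCompletion.toLinearMap denseRange_toHCompletion polyToPowerSeries hd
    (exists_continuousLinearMap_extension _ denseRange_toHCompletion _ powerSeries_withSeminorms
      fun n => by
        obtain ⟨r, hr, h⟩ := exists_continuous_seminorm_completion (truncSeminorm_stable hq hq1 n)
        refine ⟨r, hr, fun f => ?_⟩
        refine le_trans ?_ (h f).ge
        change ‖PowerSeries.coeff n (f : PowerSeries ℂ)‖ ≤ _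
        rw [Polynomial.coeff_coe]
        exact norm_coeff_le_truncSeminorm n f)
    (exists_continuousLinearMap_extension _ hd _
      (PolynormableSpace.withSeminorms ℂ (qAction q).HCompletion) fun r => by
        obtain ⟨p, hp, hrp⟩ := hS.exists_le_completion r.2
        obtain ⟨N, C, hC, h⟩ := stable_le_truncSeminorm hq hq1 hp
        have hsum : ∀ g : PowerSeries ℂ, (∑ n ∈ Finset.range (N + 1),
            (normSeminorm ℂ ℂ).comp (PowerSeries.coeff (R := ℂ) n)) g =
            ∑ n ∈ Finset.range (N + 1), ‖PowerSeries.coeff n g‖ := fun g => by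
          rw [sum_apply]; rfl
        -- A truncated norm involves only the coefficients up to degree N, so the same finite sum
        -- makes sense, and is continuous, on power series.
        refine ⟨C.toNNReal • ∑ n ∈ Finset.range (N + 1),
          (normSeminorm ℂ ℂ).comp (PowerSeries.coeff (R := ℂ) n), ?_, fun f => ?_⟩
        · refine Continuous.const_smul ?_ _
          rw [funext hsum]
          refine continuous_finsetSum _ fun n _ => ?_
          exact continuous_norm.comp (PowerSeries.WithPiTopology.continuous_coeff ℂ n)
        · refine ((hrp f).trans (h f)).trans_eq ?_
          rw [truncSeminorm_eq_sum, smul_apply, hsum, NNReal.smul_def, Real.coe_toNNReal _ hC,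
            smul_eq_mul]
          simp [polyToPowerSeries])
  refine ⟨{ e with
    map_mul' := map_mul_of_denseRange denseRange_toHCompletion (map_mul _)
      (fun a b => Polynomial.coe_mul a b) e.toContinuousLinearMap he
    commutes' := fun c => ?_ }, he⟩
  rw [← (qAction q).toHCompletion.commutes c]
  refine (he _).trans ?_
  exact Polynomial.coe_C c

end PowerSeries

/-! ### The Arens-Michael envelope of the quantum plane -/

section Quantum

variable {q : ℂ}

/-- The exponent (m₁ + n₁)(m₂ + n₂) provides m₁m₂ and n₁n₂ for the two weights and m₂n₁ to cancel
the scalar of the product. The remaining factor |q|^{m₁n₂} is at most 1 because |q| < 1. -/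
theorem basisSeminorm_quantumWeight_submul (hq : q ≠ 0) (hq1 : ‖q‖ < 1)
    (ρ : {ρ : ℝ≥0 // 0 < ρ}) :
    basisSeminorm (smashBasis q) (quantumWeight q ρ) ∈ submulSeminorms (qAction q).Smash := by
  refine basisSeminorm_mem_submulSeminorms _ _ fun m n => ?_
  rw [smashBasis_mul, map_smul_eq_mul, basisSeminorm_basis, norm_inv, norm_pow]
  have hq0 : 0 < ‖q‖ := norm_pos_iff.2 hq
  rw [inv_mul_le_iff₀ (by positivity)]
  simp only [quantumWeight, NNReal.coe_mul, NNReal.coe_pow, coe_nnnorm, Prod.fst_add,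
    Prod.snd_add]
  have h1 : ‖q‖ ^ (m.1 * n.2) ≤ 1 := pow_le_one₀ hq0.le hq1.le
  calc ‖q‖ ^ ((m.1 + n.1) * (m.2 + n.2)) * (ρ.1 : ℝ) ^ (m.1 + n.1 + (m.2 + n.2))
      = ‖q‖ ^ (m.1 * n.2) * (‖q‖ ^ (m.2 * n.1) * (‖q‖ ^ (m.1 * m.2) * (ρ.1 : ℝ) ^ (m.1 + m.2) *
        (‖q‖ ^ (n.1 * n.2) * (ρ.1 : ℝ) ^ (n.1 + n.2)))) := by ring
    _ ≤ _ := mul_le_of_le_one_left (by positivity) h1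

/-- After the reordering x^i y^j = q^{ij} y^j x^i, submultiplicativity bounds the seminorm by
|q|^{ij} p(1)² p(y)^j p(x)^i. -/
theorem submul_le_quantumWeight (hq : q ≠ 0) {p : Seminorm ℂ (qAction q).Smash}
    (hp : p ∈ submulSeminorms (qAction q).Smash) :
    ∃ (ρ : {ρ : ℝ≥0 // 0 < ρ}) (C : ℝ≥0),
      ∀ u, p u ≤ C * basisSeminorm (smashBasis q) (quantumWeight q ρ) u := by
  set X := smashBasis q (1, 0)
  set Y := smashBasis q (0, 1)
  -- One radius dominating both generators; the 1 makes it positive.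
  let ρ : ℝ≥0 := NNReal.mk (p X + p Y + 1) (by positivity)
  have hρ : 0 < ρ := by
    change (0 : ℝ) < p X + p Y + 1
    positivity
  refine ⟨⟨ρ, hρ⟩, NNReal.mk (p 1 * p 1) (by positivity), le_basisSeminorm _ _ fun n => ?_⟩
  have hX : p X ≤ ρ := by
    change p X ≤ p X + p Y + 1
    linarith [apply_nonneg p Y]
  have hY : p Y ≤ ρ := by
    change p Y ≤ p X + p Y + 1
    linarith [apply_nonneg p X]
  simp only [quantumWeight, NNReal.coe_mul, NNReal.coe_pow, coe_nnnorm, NNReal.coe_mk]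
  calc p (smashBasis q n) = ‖q‖ ^ (n.1 * n.2) * p (Y ^ n.2 * X ^ n.1) := by
        rw [show n = (n.1, n.2) from rfl, smashBasis_eq_smul q hq, map_smul_eq_mul, norm_pow]
    _ ≤ ‖q‖ ^ (n.1 * n.2) * ((p 1 * p Y ^ n.2) * (p 1 * p X ^ n.1)) := by
        gcongr
        exact (hp _ _).trans (mul_le_mul (submul_pow_le hp _ _) (submul_pow_le hp _ _)
          (apply_nonneg _ _) (mul_nonneg (apply_nonneg _ _) (by positivity)))
    _ ≤ ‖q‖ ^ (n.1 * n.2) * ((p 1 * ρ ^ n.2) * (p 1 * ρ ^ n.1)) := by gcongr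
    _ = _ := by ring

/-- The Arens-Michael envelope of an algebra isomorphic to `ℂ[x] # ℂℤ₊`. -/
theorem exists_amEnvelope_equiv (hq : q ≠ 0) (hq1 : ‖q‖ < 1) {B : Type*} [Ring B] [Algebra ℂ B]
    (σ : B ≃ₐ[ℂ] (qAction q).Smash) :
    ∃ e : AMEnvelope B ≃L[ℂ] WeightedSpace (quantumWeight q),
      ∀ u, e (toAMEnvelope B u) =
        WeightedSpace.ofBasis (smashBasis q) (quantumWeight q) (σ u) := by
  have : CompleteLCS (WeightedSpace (quantumWeight q)) :=
    WeightedSpace.completeLCS (quantumWeight_pos hq)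
  have hS : SemTop.Saturated (submulSeminorms B) := SubmulFamily.saturated
  have hd : DenseRange (WeightedSpace.ofBasis (smashBasis q) (quantumWeight q) ∘ₗ
      σ.toLinearMap) := fun c => by
    refine closure_mono ?_ (WeightedSpace.denseRange_ofBasis (smashBasis q) c)
    rintro _ ⟨u, rfl⟩
    exact ⟨σ.symm u, by simp⟩
  refine exists_continuousLinearEquiv_extension (toAMEnvelope B).toLinearMap
    (denseRange_toAMEnvelope B)
    (WeightedSpace.ofBasis (smashBasis q) (quantumWeight q) ∘ₗ σ.toLinearMap) hd
    (exists_continuousLinearMap_extension _ (denseRange_toAMEnvelope B) _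
      WeightedSpace.withSeminorms_sem fun ρ => ?_)
    (exists_continuousLinearMap_extension _ hd _
      (PolynormableSpace.withSeminorms ℂ (AMEnvelope B)) fun r => ?_)
  · have hm : (basisSeminorm (smashBasis q) (quantumWeight q ρ)).comp σ.toLinearMap ∈
        submulSeminorms B := fun a b => by
      simp only [Seminorm.comp_apply, AlgEquiv.toLinearMap_apply, map_mul]
      exact basisSeminorm_quantumWeight_submul hq hq1 ρ _ _
    obtain ⟨r, hr, h⟩ := exists_continuous_seminorm_completion hm
    exact ⟨r, hr, fun u => (h u).ge⟩
  · obtain ⟨p, hp, hrp⟩ := hS.exists_le_completion r.2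
    have hm : p.comp σ.symm.toLinearMap ∈ submulSeminorms (qAction q).Smash := fun a b => by
      simp only [Seminorm.comp_apply, AlgEquiv.toLinearMap_apply, map_mul]
      exact hp _ _
    obtain ⟨ρ, C, h⟩ := submul_le_quantumWeight hq hm
    refine ⟨C • WeightedSpace.sem (quantumWeight q) ρ,
      (WeightedSpace.continuous_sem ρ).const_smul C, fun u => (hrp u).trans ?_⟩
    have := h (σ u)
    rw [Seminorm.comp_apply, AlgEquiv.toLinearMap_apply, AlgEquiv.symm_apply_apply] at this
    exact this

end Quantum

/-! ### The analytic smash product -/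

namespace ModuleAlgebra

variable {H A G : Type*} [Ring H] [Bialgebra ℂ H] [Ring A] [Algebra ℂ A] (ρ : ModuleAlgebra H A)
  [AddCommGroup G] [Module ℂ G] [UniformSpace G]

/-- A linear map on `A # H`, seen as a bilinear map on the topologised factors. -/
def smashBilin (T : ρ.Smash →ₗ[ℂ] G) : ρ.StableTop →ₗ[ℂ] AMTop H →ₗ[ℂ] G :=
  (TensorProduct.mk ℂ A H).compr₂ (show A ⊗[ℂ] H →ₗ[ℂ] G from T)

/-- The universal property of `Ã #̂ Ĥ` as a locally convex space. -/
theorem exists_analyticSmash_lift [CompleteLCS G] (T : ρ.Smash →ₗ[ℂ] G)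
    (hT : ∀ r : Seminorm ℂ G, Continuous r → ∃ p ∈ ρ.stableSeminorms, ∃ p' ∈ submulSeminorms H,
      ∀ a h, r (T (ρ.smashTmul a h)) ≤ p a * p' h) :
    ∃ φ : ρ.AnalyticSmash →L[ℂ] G, ∀ u, φ (ρ.toAnalyticSmash u) = T u := by
  have hc : Continuous fun z : ρ.StableTop × AMTop H => ρ.smashBilin T z.1 z.2 := by
    refine continuous_of_bound _ fun r hr => ?_
    obtain ⟨p, hp, p', hp', h⟩ := hT r hr
    exact ⟨p, p', SemTop.continuous_of_mem _ hp, SemTop.continuous_of_mem _ hp', h⟩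
  let β : CBilin ρ.StableTop (AMTop H) G := ⟨ρ.smashBilin T, hc⟩
  -- The bound on elementary tensors is joint continuity on A × H. The bilinear map therefore
  -- extends to the completions of both factors before it is linearised.
  let φ : ρ.AnalyticSmash →L[ℂ] G := CTP.lift (β.extend (toCompl _) (toCompl _)
    isDenseInducing_toCompl isDenseInducing_toCompl)
  refine ⟨φ, fun u => ?_⟩
  have h : φ.toLinearMap ∘ₗ ρ.canLin = (show A ⊗[ℂ] H →ₗ[ℂ] G from T) := by
    refine TensorProduct.ext' fun a h => ?_
    refine (CTP.lift_mk _ _ _).trans ?_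
    exact CBilin.extend_apply β _ _ _ _ (show ρ.StableTop from a) (show AMTop H from h)
  exact LinearMap.congr_fun h u

end ModuleAlgebra

section Formal

variable {q : ℂ}

/-- The formal-entire weight is the product of the truncation weight in i and ρ^j in j, so equality
holds on basis tensors. Domination is then applied in each variable separately. -/
theorem sem_ofBasis_smashTmul_le (i : {ρ : ℝ≥0 // 0 < ρ} × ℕ) (a : Polynomial ℂ)
    (h : AddMonoidAlgebra ℂ ℕ) :
    WeightedSpace.sem formalEntireWeight i (WeightedSpace.ofBasis (smashBasis q) formalEntireWeight
      ((qAction q).smashTmul a h)) ≤ truncSeminorm i.2 a * expSeminorm i.1.1 h := by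
  let T : Polynomial ℂ ⊗[ℂ] AddMonoidAlgebra ℂ ℕ →ₗ[ℂ] WeightedSpace formalEntireWeight :=
    WeightedSpace.ofBasis (smashBasis q) formalEntireWeight
  have h1 : ∀ (n : ℕ) (h : AddMonoidAlgebra ℂ ℕ),
      WeightedSpace.sem formalEntireWeight i (T ((Polynomial.X ^ n) ⊗ₜ h)) ≤
        truncWeight i.2 n * expSeminorm i.1.1 h := by
    intro n
    refine le_basisSeminorm _ _ (p := (WeightedSpace.sem formalEntireWeight i).comp
      (T ∘ₗ TensorProduct.mk ℂ _ _ (Polynomial.X ^ n))) fun j => ?_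
    have hb : T ((Polynomial.X ^ n) ⊗ₜ AddMonoidAlgebra.basis ℕ ℂ j) =
        WeightedSpace.ofBasis (smashBasis q) formalEntireWeight (smashBasis q (n, j)) := by
      rw [smashBasis_apply]; rfl
    rw [Seminorm.comp_apply, LinearMap.comp_apply, TensorProduct.mk_apply, hb,
      WeightedSpace.sem_ofBasis, basisSeminorm_basis]
    simp only [formalEntireWeight, truncWeight]
    split_ifs <;> simp
  rw [mul_comm]
  refine le_basisSeminorm _ _ (p := (WeightedSpace.sem formalEntireWeight i).comp
    (T ∘ₗ (TensorProduct.mk ℂ _ _).flip h)) (fun n => ?_) a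
  rw [mul_comm, basisMonomials_eq_X_pow]
  exact h1 n h

theorem exists_analyticSmash_to_formal (hq : q ≠ 0) (hq1 : ‖q‖ < 1) :
    ∃ φ : (qAction q).AnalyticSmash →L[ℂ] WeightedSpace formalEntireWeight,
      ∀ u, φ ((qAction q).toAnalyticSmash u) = WeightedSpace.ofBasis (smashBasis q) formalEntireWeight u := by
  refine (qAction q).exists_analyticSmash_lift _ fun r hr => ?_
  obtain ⟨i, C, h⟩ := exists_le_sem_formalEntireWeight r hr
  have hS : SemTop.Saturated (qAction q).stableSeminorms := SubmulFamily.saturated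
  -- The constant is absorbed into the stable seminorm. It is raised to at least 1 because only such
  -- multiples are sure to remain submultiplicative.
  refine ⟨max C 1 • truncSeminorm i.2,
    hS.smul_mem _ (truncSeminorm_stable hq hq1 i.2) _ (le_max_right _ _),
    expSeminorm i.1.1, expSeminorm_submul i.1.1, fun a u => (h _).trans ?_⟩
  rw [smul_apply, NNReal.smul_def, smul_eq_mul, mul_assoc]
  exact mul_le_mul (NNReal.coe_le_coe.2 (le_max_left _ _)) (sem_ofBasis_smashTmul_le i a u)
    (apply_nonneg _ _) (max C 1).2

/-- On x^i ⊗ δ_j a continuous seminorm is at most p(x^i) p'(δ_j), with p stable and p'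
submultiplicative. The first factor vanishes for i > N, and the second is at most p'(1) p'(δ₁)^j. -/
theorem analyticSmash_seminorm_le (hq : q ≠ 0) (hq1 : ‖q‖ < 1)
    (r : Seminorm ℂ (qAction q).AnalyticSmash) (hr : Continuous r) :
    ∃ (i : {ρ : ℝ≥0 // 0 < ρ} × ℕ) (C : ℝ≥0), ∀ u, r ((qAction q).toAnalyticSmash u) ≤
      C * basisSeminorm (smashBasis q) (formalEntireWeight i) u := by
  obtain ⟨P, Q, hP, hQ, h⟩ := (CTP.tmul (qAction q).HCompletion
    (AMEnvelope (AddMonoidAlgebra ℂ ℕ))).exists_bound r hr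
  have hS : SemTop.Saturated (qAction q).stableSeminorms := SubmulFamily.saturated
  have hS' : SemTop.Saturated (submulSeminorms (AddMonoidAlgebra ℂ ℕ)) := SubmulFamily.saturated
  obtain ⟨p, hp, hPp⟩ := hS.exists_le_completion hP
  obtain ⟨p', hp', hQp'⟩ := hS'.exists_le_completion hQ
  obtain ⟨N, C, hC, hN⟩ := stable_le_truncWeight hq hq1 hp
  let ρ : ℝ≥0 := NNReal.mk (p' (delta 1) + 1) (by positivity)
  have hρ : 0 < ρ := by
    change (0 : ℝ) < p' (delta 1) + 1
    positivity
  have hρ' : p' (delta 1) ≤ ρ := by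
    change p' (delta 1) ≤ p' (delta 1) + 1
    linarith
  refine ⟨(⟨ρ, hρ⟩, N), NNReal.mk (C * p' 1) (by positivity), le_basisSeminorm _ _
    (p := r.comp (qAction q).toAnalyticSmash.toLinearMap) fun n => ?_⟩
  rw [smashBasis_apply, NNReal.coe_mk]
  have h2 : p' (delta n.2) ≤ p' 1 * ρ ^ n.2 := by
    rw [← delta_one_pow]
    refine (submul_pow_le hp' _ _).trans ?_
    gcongr
  calc r ((qAction q).toAnalyticSmash ((qAction q).smashTmul (Polynomial.X ^ n.1) (delta n.2)))
      ≤ P ((qAction q).toHCompletion (Polynomial.X ^ n.1)) *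
          Q (toAMEnvelope _ (delta n.2)) := h _ _
    _ ≤ p (Polynomial.X ^ n.1) * p' (delta n.2) :=
        mul_le_mul (hPp _) (hQp' _) (apply_nonneg _ _) (apply_nonneg _ _)
    _ ≤ (C * truncWeight N n.1) * (p' 1 * ρ ^ n.2) :=
        mul_le_mul (hN _) h2 (apply_nonneg _ _) (by positivity)
    _ = _ := by
        simp only [formalEntireWeight, truncWeight]
        split_ifs <;> simp; ring

theorem denseRange_toAnalyticSmash : DenseRange (qAction q).toAnalyticSmash :=
  (qAction q).denseRange_canLin

theorem exists_analyticSmash_equiv (hq : q ≠ 0) (hq1 : ‖q‖ < 1) :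
    ∃ e : (qAction q).AnalyticSmash ≃L[ℂ] WeightedSpace formalEntireWeight,
      ∀ u, e ((qAction q).toAnalyticSmash u) =
        WeightedSpace.ofBasis (smashBasis q) formalEntireWeight u := by
  refine exists_continuousLinearEquiv_extension (qAction q).toAnalyticSmash.toLinearMap
    denseRange_toAnalyticSmash _ (WeightedSpace.denseRange_ofBasis _)
    (exists_analyticSmash_to_formal hq hq1)
    (exists_continuousLinearMap_extension _ (WeightedSpace.denseRange_ofBasis _) _
      (PolynormableSpace.withSeminorms ℂ (qAction q).AnalyticSmash) fun r => ?_)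
  obtain ⟨i, C, h⟩ := analyticSmash_seminorm_le hq hq1 r.1 r.2
  exact ⟨C • WeightedSpace.sem formalEntireWeight i, (WeightedSpace.continuous_sem i).const_smul C, h⟩

/-! ### Comparison of the two completions: existence of the canonical map and failure of
surjectivity -/

theorem exists_formalEntireWeight_le_quantumWeight (hq : q ≠ 0) (hq1 : ‖q‖ < 1)
    (i : {ρ : ℝ≥0 // 0 < ρ} × ℕ) : ∃ ρ, ∀ n, formalEntireWeight i n ≤ quantumWeight q ρ n := by
  have hq0 : 0 < ‖q‖₊ := nnnorm_pos.2 hq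
  -- For first exponents at most N one has |q|^{ij} ≥ |q|^{Nj}, so enlarging the radius by |q|^{-N}
  -- compensates the loss in every power of y. The maximum with 1 ensures that the additional powers
  -- of ρ coming from x only increase the weight.
  let ρ : ℝ≥0 := max 1 (i.1.1 * (‖q‖₊ ^ i.2)⁻¹)
  have h1 : 1 ≤ ρ := le_max_left _ _
  have h2 : i.1.1 ≤ ‖q‖₊ ^ i.2 * ρ := by
    calc i.1.1 = ‖q‖₊ ^ i.2 * (i.1.1 * (‖q‖₊ ^ i.2)⁻¹) := by field_simp
      _ ≤ _ := by gcongr; exact le_max_right _ _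
  refine ⟨⟨ρ, one_pos.trans_le h1⟩, fun n => ?_⟩
  simp only [formalEntireWeight, quantumWeight]
  split_ifs with hn
  · calc i.1.1 ^ n.2 ≤ (‖q‖₊ ^ i.2 * ρ) ^ n.2 := by gcongr
      _ = ‖q‖₊ ^ (i.2 * n.2) * ρ ^ n.2 := by rw [mul_pow, pow_mul]
      _ ≤ ‖q‖₊ ^ (n.1 * n.2) * ρ ^ (n.1 + n.2) :=
        mul_le_mul' (pow_le_pow_of_le_one zero_le (show ‖q‖₊ ≤ 1 from hq1.le) (by gcongr))
          (pow_le_pow_right₀ h1 (by omega))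
  · exact zero_le

/-- The canonical map `(A # H)^ → Ã #̂ Ĥ`. -/
theorem exists_amEnvelope_to_analyticSmash (hq : q ≠ 0) (hq1 : ‖q‖ < 1) :
    ∃ Φ : AMEnvelope (qAction q).Smash →A[ℂ] (qAction q).AnalyticSmash,
      ∀ u, Φ (toAMEnvelope (qAction q).Smash u) = (qAction q).toAnalyticSmash u := by
  have hd := denseRange_toAMEnvelope (qAction q).Smash
  obtain ⟨φ, hφ⟩ := exists_continuousLinearMap_extension
    (toAMEnvelope (qAction q).Smash).toLinearMap hd (qAction q).toAnalyticSmash.toLinearMap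
    (PolynormableSpace.withSeminorms ℂ (qAction q).AnalyticSmash) fun r => by
      obtain ⟨i, C, h⟩ := analyticSmash_seminorm_le hq hq1 r.1 r.2
      obtain ⟨ρ, hρ⟩ := exists_formalEntireWeight_le_quantumWeight hq hq1 i
      obtain ⟨s, hs, hsu⟩ := exists_continuous_seminorm_completion
        (basisSeminorm_quantumWeight_submul hq hq1 ρ)
      refine ⟨C • s, hs.const_smul C, fun u => (h u).trans ?_⟩
      refine mul_le_mul_of_nonneg_left ((basisSeminorm_mono _ hρ u).trans ?_) C.2
      exact (hsu u).ge
  refine ⟨⟨AlgHom.ofLinearMap φ.toLinearMap ?_ ?_, φ.continuous⟩, hφ⟩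
  · exact (congrArg φ (map_one (toAMEnvelope (qAction q).Smash)).symm).trans
      ((hφ 1).trans (map_one (qAction q).toAnalyticSmash))
  · exact map_mul_of_denseRange hd (map_mul _) (map_mul (qAction q).toAnalyticSmash) φ hφ

/-- The formal series `∑ xⁱ`. -/
def geometricSeries : WeightedSpace formalEntireWeight :=
  (⟨fun n => if n.2 = 0 then 1 else 0, fun i => by
    refine summable_of_hasFiniteSupport (((Set.finite_Iic i.2).prod
      (Set.finite_singleton 0)).subset fun n hn => ?_)
    simp only [formalEntireWeight, Function.mem_support] at hn
    split_ifs at hn with h1 h2 <;> simp_all⟩ : weightedSubmodule formalEntireWeight)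

/-- In coordinates Φ preserves every coefficient. A preimage of ∑ x^i would thus have all
coefficients of x^i equal to 1, contradicting summability in the envelope. The series belongs to the
formal space because there each seminorm sees only finitely many powers of x. -/
theorem not_surjective_of_extends (hq : q ≠ 0) (hq1 : ‖q‖ < 1)
    (Φ : AMEnvelope (qAction q).Smash →L[ℂ] (qAction q).AnalyticSmash)
    (hΦ : ∀ u, Φ (toAMEnvelope (qAction q).Smash u) = (qAction q).toAnalyticSmash u) :
    ¬ Function.Surjective Φ := by
  intro hs
  obtain ⟨e, he⟩ := exists_analyticSmash_equiv hq hq1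
  obtain ⟨e', he'⟩ := exists_amEnvelope_equiv hq hq1 (AlgEquiv.refl (A₁ := (qAction q).Smash))
  obtain ⟨z, hz⟩ := hs (e.symm geometricSeries)
  -- Both sides are continuous in z and agree on the dense image of the smash product, where both
  -- are coefficients in the monomial basis.
  have hcoord : ∀ n, (e (Φ z)).coord n = (e' z).coord n := fun n =>
    congr_fun ((denseRange_toAMEnvelope (qAction q).Smash).equalizer
      (g := fun z => WeightedSpace.coordLin _ n (e (Φ z)))
      (h := fun z => WeightedSpace.coordLin _ n (e' z))
      ((WeightedSpace.continuous_coordLin formalEntireWeight_pos n).comp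
        (e.continuous.comp Φ.continuous))
      ((WeightedSpace.continuous_coordLin (quantumWeight_pos hq) n).comp e'.continuous)
      (funext fun u => by
        simp only [Function.comp_apply, hΦ, he, he']
        rfl)) z
  have h1 := WeightedSpace.summable_coord (e' z) ⟨1, one_pos⟩
  simp only [← hcoord, hz, ContinuousLinearEquiv.apply_symm_apply] at h1
  -- Restriction to y^0: there |q|^{ij} = 1, and with ρ = 1 the weights are constantly 1.
  have h2 := h1.comp_injective (i := fun i : ℕ => (i, 0)) fun a b h => (Prod.mk.inj h).1
  have h3 : Summable fun _ : ℕ => (1 : ℝ) := by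
    refine h2.congr fun i => ?_
    simp [quantumWeight, geometricSeries, WeightedSpace.coord]
  exact one_ne_zero ((summable_const_iff 1).1 h3)

end Formal

end AMSmash

end

theorem mainTheorem2 (q : ℂ) (hq : q ≠ 0) :
    -- the semigroup bialgebra `ℂℤ₊` admits no antipode
    (¬ ∃ S : HopfAlgebra ℂ (AddMonoidAlgebra ℂ ℕ),
      S.toHopfAlgebraStruct.toBialgebra = AddMonoidAlgebra.instBialgebra ℂ ℂ ℕ) ∧
    -- the action is `(k • f)(x) = f(q⁻ᵏ x)`
    (∀ (k : ℕ) (f : Polynomial ℂ), (qAction q).act (delta k) f =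
      f.comp (Polynomial.C (q ^ k)⁻¹ * Polynomial.X)) ∧
    -- `A # H` is the quantum plane
    (∃ e : QuantumPlane q ≃ₐ[ℂ] (qAction q).Smash,
      e (QuantumPlane.x q) = (qAction q).smashTmul Polynomial.X 1 ∧
      e (QuantumPlane.y q) = (qAction q).smashTmul 1 (delta 1)) ∧
    (‖q‖ < 1 →
      -- `Ã` is `ℂ[[x]]` with the topology of coordinatewise convergence
      (∃ e : (qAction q).HCompletion ≃A[ℂ] PowerSeries ℂ,
        ∀ f : Polynomial ℂ, e ((qAction q).toHCompletion f) = (f : PowerSeries ℂ)) ∧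
      -- the locally convex space `Ã #̂ Ĥ`
      (∃ e : (qAction q).AnalyticSmash ≃L[ℂ] WeightedSpace formalEntireWeight,
        ∀ i j : ℕ, (e ((qAction q).toAnalyticSmash
          ((qAction q).smashTmul (Polynomial.X ^ i) (delta j)))).coord = Pi.single (i, j) 1) ∧
      -- the locally convex space underlying the Arens-Michael envelope of the quantum plane
      (∃ e : AMEnvelope (QuantumPlane q) ≃L[ℂ] WeightedSpace (quantumWeight q),
        ∀ i j : ℕ, (e (toAMEnvelope (QuantumPlane q)
          (QuantumPlane.x q ^ i * QuantumPlane.y q ^ j))).coord = Pi.single (i, j) 1) ∧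
      -- the canonical map `(A # H)^ → Ã #̂ Ĥ` exists, is unique, and is not onto
      (∃ Φ : AMEnvelope (qAction q).Smash →A[ℂ] (qAction q).AnalyticSmash,
        (∀ u, Φ (toAMEnvelope (qAction q).Smash u) = (qAction q).toAnalyticSmash u) ∧
        (∀ Ψ : AMEnvelope (qAction q).Smash →A[ℂ] (qAction q).AnalyticSmash,
          (∀ u, Ψ (toAMEnvelope (qAction q).Smash u) = (qAction q).toAnalyticSmash u) → Ψ = Φ) ∧
        ¬ Function.Surjective Φ) ∧
      -- the canonical map `A # H → Ã #̂ Ĥ` does not extend to a topological isomorphism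
      ¬ ∃ e : AMEnvelope (qAction q).Smash ≃A[ℂ] (qAction q).AnalyticSmash,
        ∀ u, e (toAMEnvelope (qAction q).Smash u) = (qAction q).toAnalyticSmash u) := by
  refine ⟨not_exists_hopfAlgebra, qAction_act_delta q, ⟨QuantumPlane.equivSmash q hq, ?_, ?_⟩,
    fun hq1 => ⟨exists_hCompletion_equiv hq hq1, ?_, ?_, ?_, ?_⟩⟩
  · exact (QuantumPlane.toSmash_x q hq).trans (by rw [smashBasis_apply, pow_one, delta_zero])
  · exact (QuantumPlane.toSmash_y q hq).trans (by rw [smashBasis_apply, pow_zero])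
  · obtain ⟨e, he⟩ := exists_analyticSmash_equiv hq hq1
    refine ⟨e, fun i j => ?_⟩
    rw [he, ← smashBasis_apply q (i, j), WeightedSpace.ofBasis_basis, WeightedSpace.coord_single]
  · obtain ⟨e, he⟩ := exists_amEnvelope_equiv hq hq1 (QuantumPlane.equivSmash q hq)
    refine ⟨e, fun i j => ?_⟩
    rw [he, QuantumPlane.equivSmash_pow_mul_pow, WeightedSpace.ofBasis_basis,
      WeightedSpace.coord_single]
  · obtain ⟨Φ, hΦ⟩ := exists_amEnvelope_to_analyticSmash hq hq1
    refine ⟨Φ, hΦ, fun Ψ hΨ => ?_, not_surjective_of_extends hq hq1 Φ.toContinuousLinearMap hΦ⟩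
    -- Continuous maps into a Hausdorff space are determined by their values on a dense subset.
    exact DFunLike.coe_injective ((denseRange_toAMEnvelope (qAction q).Smash).equalizer
      Ψ.cont Φ.cont (funext fun u => (hΨ u).trans (hΦ u).symm))
  · rintro ⟨e, he⟩
    -- An isomorphism extending j would in particular be a surjective continuous extension of j.
    exact not_surjective_of_extends hq hq1 e.toContinuousAlgHom.toContinuousLinearMap he
      e.surjective
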